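/- Let $d\ge 1$, let $X,Y\subset\mathbb R^d$ be bounded convex open sets, let $\mu$ be a Borel probability measure on $X$, and let $\nu$ be a Borel probability measure on $Y$ which is absolutely continuous with respect to Lebesgue measure and whose density is bounded away from zero on $Y$ (it is at least some constant $a>0$ almost everywhere on $Y$). An upper semicontinuous function $\psi:Y\to[-\infty,\infty)$ is called subharmonic on $Y$ if its value at the centre of every closed ball contained in $Y$ is at most its mean, with respect to surface measure, over the boundary sphere of that ball. Let $\mathcal A_{\mathrm{sh}}$ be the set of subharmonic functions on $Y$ which are bounded from below, and let $C_b(Y)$ be the set of bounded continuous functions on $Y$. For probability measures $\eta,\nu$ on $Y$ write $\eta\leqslant_{\mathrm{sh}}\nu$ if $\int_Y\psi\,d\eta\le\int_Y\psi\,d\nu$ for every subharmonic $\psi\in C_b(Y)$, and put $\mathrm P^{\mathrm{sh}}_{\leqslant\nu}=\{\eta\in P(Y):\eta\leqslant_{\mathrm{sh}}\nu\}$. For $\psi$ bounded from below on $Y$ put $Q_2(\psi)(x)=\inf_{y\in Y}\{\psi(y)+|x-y|^2\}$, and let $$\mathcal D_2(\mu,\mathrm P^{\mathrm{sh}}_{\leqslant\nu})=\sup_{\psi\in\mathcal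 A_{\mathrm{sh}}\cap C_b(Y)}\Big\{\int_X Q_2(\psi)\,d\mu-\int_Y\psi\,d\nu\Big\}.$$ Let $\mathcal T_2(\mu,\eta)=\inf_\pi\int|x-y|^2\,d\pi(x,y)$, the infimum being over all couplings $\pi$ of $\mu$ and $\eta$. A backward subharmonic order projection of $\mu$ is a measure $\bar\mu\in\mathrm P^{\mathrm{sh}}_{\leqslant\nu}$ with $\mathcal T_2(\mu,\bar\mu)=\inf_{\eta\in\mathrm P^{\mathrm{sh}}_{\leqslant\nu}}\mathcal T_2(\mu,\eta)$. Then there exists $\psi_0\in\mathcal A_{\mathrm{sh}}\cap L^1(Y,\nu)$ (in particular bounded from below), with $Q_2(\psi_0)\in L^1(X,\mu)$, such that $$\mathcal D_2(\mu,\mathrm P^{\mathrm{sh}}_{\leqslant\nu})\le\int_X Q_2(\psi_0)\,d\mu-\int_Y\psi_0\,d\nu .$$ If in addition some backward subharmonic order projection $\bar\mu$ of $\mu$ satisfies $$\int_Y\psi_0\,d\bar\mu\le\int_Y\psi_0\,d\nu ,$$ then $\psi_0$ attains the optimal dual value, that is, $$\mathcal D_2(\mu,\mathrm P^{\mathrm{sh}}_{\leqslant\nu})=\int_X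 Q_2(\psi_0)\,d\mu-\int_Y\psi_0\,d\nu .$$ -/

import Mathlib

open MeasureTheory Set
open scoped ENNReal NNReal

noncomputable section

namespace SubharmonicProjection

/-- The Euclidean space `ℝ^d`. -/
abbrev Space (d : ℕ) : Type := EuclideanSpace ℝ (Fin d)

/-- `μ ∈ P(U)`: a Borel probability measure on `ℝ^d` carried by `U`. -/
def IsProbOn {d : ℕ} (U : Set (Space d)) (μ : Measure (Space d)) : Prop :=
  IsProbabilityMeasure μ ∧ μ Uᶜ = 0

/-- A real-valued function is subharmonic on the open set `U` if it is upper semicontinuous on `U`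
and its value at `x` is at most its mean, for surface measure, over the sphere `∂B_r(x)`,
for each closed ball `B_r(x) ⊆ U`. The sphere `∂B_r(x)` is parametrized by the unit sphere through
`θ ↦ x + r • θ`, and `volume.toSphere` is the surface measure of the unit sphere. As `ψ x` is
finite, the inequality contains the finiteness of the mean. -/
def IsSubharmonicOn {d : ℕ} (ψ : Space d → ℝ) (U : Set (Space d)) : Prop :=
  UpperSemicontinuousOn ψ U ∧
    ∀ (x : Space d) (r : ℝ), 0 < r → Metric.closedBall x r ⊆ U →
      Integrable (fun θ : Metric.sphere (0 : Space d) 1 => ψ (x + r • (θ : Space d)))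
          (volume : Measure (Space d)).toSphere ∧
        ψ x ≤ ⨍ θ : Metric.sphere (0 : Space d) 1, ψ (x + r • (θ : Space d))
          ∂(volume : Measure (Space d)).toSphere

/-- The class of subharmonic functions on `U` which are bounded from below on `U`.
A subharmonic function may in general take the value `-∞`; one that is bounded from below is
real-valued, so real-valued functions suffice. Only the values on `U` matter. -/
def SubharmonicBddBelow {d : ℕ} (U : Set (Space d)) : Set (Space d → ℝ) :=
  {ψ | IsSubharmonicOn ψ U ∧ BddBelow (ψ '' U)}

/-- The functions that are bounded and continuous on `U`. -/
def BoundedContinuousOn {d : ℕ} (U : Set (Space d)) : Set (Space d → ℝ) :=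
  {ψ | ContinuousOn ψ U ∧ ∃ C : ℝ, ∀ y ∈ U, |ψ y| ≤ C}

/-- The subharmonic order `η ≤_sh ν` on `U`. -/
def SubharmonicOrder {d : ℕ} (U : Set (Space d)) (η ν : Measure (Space d)) : Prop :=
  ∀ ψ : Space d → ℝ, IsSubharmonicOn ψ U → ψ ∈ BoundedContinuousOn U →
    ∫ y in U, ψ y ∂η ≤ ∫ y in U, ψ y ∂ν

/-- The backward cone: the measures `η ∈ P(Y)` with `η ≤_sh ν`. -/
def backwardCone {d : ℕ} (Y : Set (Space d)) (ν : Measure (Space d)) :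
    Set (Measure (Space d)) :=
  {η | IsProbOn Y η ∧ SubharmonicOrder Y η ν}

/-- The couplings of `μ` and `η`. -/
def couplings {d : ℕ} (μ η : Measure (Space d)) : Set (Measure (Space d × Space d)) :=
  {π | π.map Prod.fst = μ ∧ π.map Prod.snd = η}

/-- The quadratic transport cost `T₂(μ, η) = inf_π ∫ |x - y|² dπ`. -/
def transportCost {d : ℕ} (μ η : Measure (Space d)) : ℝ≥0∞ :=
  ⨅ π ∈ couplings μ η, ∫⁻ p, ENNReal.ofReal (‖p.1 - p.2‖ ^ 2) ∂π

/-- `μbar` is a backward projection of `μ` onto the cone of `ν`: a member of the cone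
at which the transport cost from `μ` attains its infimum over the cone. -/
def IsBackwardProjection {d : ℕ} (Y : Set (Space d)) (μ ν μbar : Measure (Space d)) : Prop :=
  μbar ∈ backwardCone Y ν ∧
    transportCost μ μbar = ⨅ η ∈ backwardCone Y ν, transportCost μ η

/-- The transform `Q₂(ψ)(x) = inf_{y ∈ Y} (ψ(y) + |x - y|²)`. -/
def quadTransform {d : ℕ} (Y : Set (Space d)) (ψ : Space d → ℝ) (x : Space d) : ℝ :=
  ⨅ y : Y, (ψ y + ‖x - y‖ ^ 2)

/-- The dual functional `∫_X Q₂(ψ) dμ - ∫_Y ψ dν`. -/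
def dualFunctional {d : ℕ} (X Y : Set (Space d)) (μ ν : Measure (Space d))
    (ψ : Space d → ℝ) : ℝ :=
  ∫ x in X, quadTransform Y ψ x ∂μ - ∫ y in Y, ψ y ∂ν

/-- The optimal dual value `D₂(μ, ν)`: the supremum, in the extended reals, of the dual functional
over the bounded continuous subharmonic functions on `Y`. -/
def dualValue {d : ℕ} (X Y : Set (Space d)) (μ ν : Measure (Space d)) : EReal :=
  ⨆ ψ ∈ SubharmonicBddBelow Y ∩ BoundedContinuousOn Y, (dualFunctional X Y μ ν ψ : EReal)

end SubharmonicProjection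

end

/-! Attainment is the direct method. Subtracting the infimum makes a maximizing sequence nonnegative
with bounded `ν`-integrals; the lower bound on the density bounds the Lebesgue integrals, and the
mean value inequality turns these into locally uniform pointwise bounds. As the dual functional is
concave, almost maximizers form decreasing midpoint convex sets, from which a Hilbert space argument
extracts an almost everywhere convergent maximizing sequence (`exists_seq_ae_tendsto`). Small ball
means regularize its limit to a subharmonic function that dominates the upper limit of the sequence
at every point (`exists_subharmonic_limit`). Fatou's lemma for the `ν`-integrals and its reverse for
the transforms then give the inequality.

For equality, Hahn-Banach and Riesz produce a measure whose first marginal is `μ`, whose second lies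
in the backward cone, and whose cost is at most the dual value (`exists_mem_backwardCone`).
Convexity of `Y` supplies subharmonic barriers which keep mass off the boundary. So the cost of a
projection is at most the dual value, while weak duality bounds it from below by the dual functional
at `ψ₀`. -/

namespace SubharmonicProjection

open MeasureTheory Set Filter Topology Metric
open scoped ENNReal NNReal Pointwise BoundedContinuousFunction

set_option linter.unusedSectionVars false

variable {d : ℕ}

/-! ### Means over balls and spheres. -/

section BallMean

variable {E : Type*} [NormedAddCommGroup E] [NormedSpace ℝ E] [FiniteDimensional ℝ E]
  [MeasurableSpace E] [BorelSpace E] (μ : Measure E) [μ.IsAddHaarMeasure]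

/-- The mean of `h` over the closed ball of radius `r` about `x`. -/
noncomputable def ballMean (r : ℝ) (h : E → ℝ≥0∞) (x : E) : ℝ≥0∞ :=
  ⨍⁻ y in closedBall x r, h y ∂μ

/-- The mean of `h`, for surface measure, over the sphere of radius `r` about `x`. -/
noncomputable def sphereMean (r : ℝ) (h : E → ℝ≥0∞) (x : E) : ℝ≥0∞ :=
  ⨍⁻ θ : sphere (0 : E) 1, h (x + r • (θ : E)) ∂μ.toSphere

/-- Polar coordinates live on the complement of the origin, a null set because `E` is nontrivial. -/
theorem lintegral_eq_lintegral_sphere_prod [Nontrivial E] {f : E → ℝ≥0∞} (hf : Measurable f) :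
    ∫⁻ x, f x ∂μ = ∫⁻ t : Ioi (0 : ℝ), ∫⁻ θ : sphere (0 : E) 1, f ((t : ℝ) • (θ : E)) ∂μ.toSphere
      ∂(Measure.volumeIoiPow (Module.finrank ℝ E - 1)) := by
  have hg : Measurable fun p : sphere (0 : E) 1 × Ioi (0 : ℝ) => f ((p.2 : ℝ) • (p.1 : E)) :=
    hf.comp (by fun_prop)
  have h := (μ.measurePreserving_homeomorphUnitSphereProd).lintegral_comp hg
  rw [lintegral_prod_symm' _ hg] at h
  rw [← h, ← restrict_compl_singleton (μ := μ) (0 : E),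
    ← lintegral_subtype_comap (measurableSet_singleton _).compl, restrict_compl_singleton]
  refine lintegral_congr fun x => ?_
  conv_lhs => rw [← (homeomorphUnitSphereProd E).symm_apply_apply x]
  rw [homeomorphUnitSphereProd_symm_apply_coe]

theorem setLIntegral_closedBall_eq_zero_center {h : E → ℝ≥0∞} (r : ℝ) (x : E) :
    ∫⁻ y in closedBall x r, h y ∂μ = ∫⁻ y in closedBall 0 r, h (x + y) ∂μ := by
  have h1 := (measurePreserving_add_left μ x).setLIntegral_comp_preimage_emb
    (measurableEmbedding_addLeft x) h (closedBall x r)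
  rw [← h1]
  congr 2
  ext y
  simp

theorem ballMean_eq (r : ℝ) (h : E → ℝ≥0∞) (x : E) :
    ballMean μ r h x = (∫⁻ y in closedBall 0 r, h (x + y) ∂μ) / μ (closedBall 0 r) := by
  rw [ballMean, setLAverage_eq, setLIntegral_closedBall_eq_zero_center,
    Measure.addHaar_closedBall_center]

theorem ballMean_eq_div (r : ℝ) (h : E → ℝ≥0∞) (x : E) :
    ballMean μ r h x = (∫⁻ y in closedBall x r, h y ∂μ) / μ (closedBall 0 r) := by
  rw [ballMean_eq, ← setLIntegral_closedBall_eq_zero_center μ r x]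

theorem measure_closedBall_ne_zero (x : E) {r : ℝ} (hr : 0 < r) : μ (closedBall x r) ≠ 0 :=
  (measure_closedBall_pos μ x hr).ne'

theorem measure_closedBall_ne_top (x : E) (r : ℝ) : μ (closedBall x r) ≠ ∞ :=
  measure_closedBall_lt_top.ne

theorem ballMean_le_ballMean {r : ℝ} {g h : E → ℝ≥0∞} {x : E}
    (hgh : ∀ y ∈ closedBall x r, g y ≤ h y) : ballMean μ r g x ≤ ballMean μ r h x := by
  rw [ballMean_eq_div, ballMean_eq_div]
  exact ENNReal.div_le_div_right (setLIntegral_mono' measurableSet_closedBall hgh) _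

theorem ballMean_le_const {r : ℝ} (hr : 0 < r) {h : E → ℝ≥0∞} {x : E} {C : ℝ≥0∞}
    (hC : ∀ y ∈ closedBall x r, h y ≤ C) : ballMean μ r h x ≤ C := by
  refine (ballMean_le_ballMean μ (h := fun _ => C) hC).trans ?_
  rw [ballMean_eq_div, setLIntegral_const, Measure.addHaar_closedBall_center,
    ENNReal.mul_div_cancel_right (measure_closedBall_ne_zero μ 0 hr)
      (measure_closedBall_ne_top μ 0 r)]

/-- A function that lies below its means over all spheres about `x` of radius at most `r` lies
below its mean over the ball. -/
theorem le_ballMean_of_le_sphereMean [Nontrivial E] {h : E → ℝ≥0∞} (hh : Measurable h) {x : E}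
    {r : ℝ} (hr : 0 < r) (hx : ∀ t, 0 < t → t ≤ r → h x ≤ sphereMean μ t h x) :
    h x ≤ ballMean μ r h x := by
  rw [ballMean_eq, ENNReal.le_div_iff_mul_le (.inl (measure_closedBall_ne_zero μ 0 hr))
    (.inl (measure_closedBall_ne_top μ 0 r)), ← setLIntegral_const,
    ← lintegral_indicator measurableSet_closedBall, ← lintegral_indicator measurableSet_closedBall,
    lintegral_eq_lintegral_sphere_prod μ (measurable_const.indicator measurableSet_closedBall),
    lintegral_eq_lintegral_sphere_prod μ
      (f := (closedBall 0 r).indicator fun y => h (x + y))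
      ((hh.comp (measurable_const_add x)).indicator measurableSet_closedBall)]
  refine lintegral_mono fun t => ?_
  have ht : (0 : ℝ) < t := t.2
  have hmem (θ : sphere (0 : E) 1) : (t : ℝ) • (θ : E) ∈ closedBall (0 : E) r ↔ (t : ℝ) ≤ r := by
    simp [norm_smul, abs_of_pos ht]
  by_cases htr : (t : ℝ) ≤ r
  · have h1 := hx t ht htr
    rw [sphereMean, laverage_eq, ENNReal.le_div_iff_mul_le
      (.inl (Measure.measure_univ_ne_zero.2 μ.toSphere_ne_zero)) (.inl (measure_ne_top _ _)),
      ← lintegral_const] at h1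
    simpa [indicator, hmem, htr] using h1
  · simp [indicator, hmem, htr]

/-- The ball means of a function that lies below its sphere means lie below their own sphere
means. -/
theorem ballMean_le_sphereMean_ballMean {h : E → ℝ≥0∞} (hh : Measurable h) {x : E} {r s : ℝ}
    (hx : ∀ z ∈ closedBall (0 : E) s, h (x + z) ≤ sphereMean μ r h (x + z)) :
    ballMean μ s h x ≤ sphereMean μ r (ballMean μ s h) x := by
  have hm : Measurable fun p : E × sphere (0 : E) 1 => h (x + p.1 + r • (p.2 : E)) :=
    hh.comp (by fun_prop)
  calc ballMean μ s h x
      ≤ (∫⁻ z in closedBall 0 s, sphereMean μ r h (x + z) ∂μ) / μ (closedBall 0 s) := by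
        rw [ballMean_eq]
        exact ENNReal.div_le_div_right (setLIntegral_mono' measurableSet_closedBall hx) _
    _ = sphereMean μ r (ballMean μ s h) x := by
        simp only [sphereMean, laverage, ballMean_eq, div_eq_mul_inv]
        rw [lintegral_mul_const _ (by
          refine Measurable.lintegral_prod_right' (f := fun p : sphere (0 : E) 1 × E =>
            h (x + r • (p.1 : E) + p.2)) (hh.comp (by fun_prop)))]
        congr 1
        rw [lintegral_lintegral_swap hm.aemeasurable]
        refine lintegral_congr fun θ => lintegral_congr fun z => ?_
        congr 1
        abel

/-- When the centre moves, the indicators of the balls converge off the limiting sphere, which is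
null; `h` itself dominates. -/
theorem continuous_ballMean [Nontrivial E] {h : E → ℝ≥0∞} (hh : Measurable h)
    (hfin : ∫⁻ y, h y ∂μ ≠ ∞) {r : ℝ} (hr : 0 < r) : Continuous (ballMean μ r h) := by
  have : ballMean μ r h = fun x => (∫⁻ y in closedBall x r, h y ∂μ) / μ (closedBall 0 r) :=
    funext (ballMean_eq_div μ r h)
  rw [this]
  refine ENNReal.continuous_div_const _ (measure_closedBall_ne_zero μ 0 hr) |>.comp ?_
  rw [continuous_iff_seqContinuous]
  intro u x hu
  simp only [Function.comp_def, ← lintegral_indicator measurableSet_closedBall]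
  refine tendsto_lintegral_of_dominated_convergence h
    (fun n => hh.indicator measurableSet_closedBall)
    (fun n => .of_forall fun y => indicator_le_self _ _ _) hfin ?_
  have hs : ∀ᵐ y ∂μ, y ∉ sphere x r :=
    measure_eq_zero_iff_ae_notMem.1 (Measure.addHaar_sphere μ x r)
  filter_upwards [hs] with y hy
  have hd : Tendsto (fun n => dist y (u n)) atTop (𝓝 (dist y x)) :=
    tendsto_const_nhds.dist hu
  rcases lt_or_gt_of_ne (show dist y x ≠ r from hy) with hlt | hgt
  · refine tendsto_const_nhds.congr' ?_
    filter_upwards [hd.eventually_lt_const hlt] with n hn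
    rw [indicator_of_mem (mem_closedBall.2 hlt.le), indicator_of_mem (mem_closedBall.2 hn.le)]
  · refine tendsto_const_nhds.congr' ?_
    filter_upwards [hd.eventually_const_lt hgt] with n hn
    rw [indicator_of_notMem (by simpa using hgt), indicator_of_notMem (by simpa using hn)]

theorem tendsto_ballMean {G : ℕ → E → ℝ≥0∞} {Φ : E → ℝ≥0∞} (hG : ∀ n, Measurable (G n))
    (hlim : ∀ᵐ y ∂μ, Tendsto (fun n => G n y) atTop (𝓝 (Φ y))) {x : E} {r : ℝ} (hr : 0 < r)
    {C : ℝ≥0∞} (hC : C ≠ ∞) (hGC : ∀ n, ∀ y ∈ closedBall x r, G n y ≤ C) :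
    Tendsto (fun n => ballMean μ r (G n) x) atTop (𝓝 (ballMean μ r Φ x)) := by
  simp only [ballMean_eq_div]
  refine ENNReal.Tendsto.div_const ?_ (.inr (measure_closedBall_ne_zero μ 0 hr))
  refine tendsto_lintegral_of_dominated_convergence (fun _ => C) hG
    (fun n => (ae_restrict_iff' measurableSet_closedBall).2 (.of_forall (hGC n))) ?_
    (ae_restrict_of_ae hlim)
  rw [setLIntegral_const]
  exact ENNReal.mul_ne_top hC (measure_closedBall_ne_top μ x r)

theorem ae_tendsto_ballMean {h : E → ℝ≥0∞} (hh : Measurable h) (hfin : ∫⁻ y, h y ∂μ ≠ ∞) :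
    ∀ᵐ x ∂μ, Tendsto (fun r => ballMean μ r h x) (𝓝[>] 0) (𝓝 (h x)) := by
  filter_upwards [(Besicovitch.vitaliFamily μ).ae_tendsto_lintegral_div' hh hfin] with x hx
  simp only [ballMean, setLAverage_eq]
  exact hx.comp (Besicovitch.tendsto_filterAt μ x)

end BallMean

/-! ### Regularization of almost everywhere limits. -/

section Limit

variable {E : Type*} [NormedAddCommGroup E] [NormedSpace ℝ E] [FiniteDimensional ℝ E]
  [MeasurableSpace E] [BorelSpace E] (μ : Measure E) [μ.IsAddHaarMeasure]

/-- The sphere mean value inequality on `Y` for a function with values in `[0, ∞]`. -/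
def SphereSubmean (Y : Set E) (h : E → ℝ≥0∞) : Prop :=
  ∀ x r, 0 < r → closedBall x r ⊆ Y → h x ≤ sphereMean μ r h x

theorem exists_closedBall_subset {Y : Set E} (hY : IsOpen Y) {x : E} (hx : x ∈ Y) :
    ∃ r > 0, closedBall x r ⊆ Y :=
  nhds_basis_closedBall.mem_iff.1 (hY.mem_nhds hx)

theorem exists_closedBall_add_subset {Y : Set E} (hY : IsOpen Y) {x : E} {r : ℝ} (hr : 0 ≤ r)
    (hx : closedBall x r ⊆ Y) : ∃ δ > 0, closedBall x (r + δ) ⊆ Y := by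
  obtain ⟨δ, hδ, h⟩ := (isCompact_closedBall x r).exists_cthickening_subset_open hY hx
  refine ⟨δ, hδ, ?_⟩
  rwa [cthickening_closedBall hδ.le hr, add_comm] at h

theorem SphereSubmean.le_ballMean [Nontrivial E] {Y : Set E} {h : E → ℝ≥0∞} (hh : Measurable h)
    (hs : SphereSubmean μ Y h) {x : E} {r : ℝ} (hr : 0 < r) (hx : closedBall x r ⊆ Y) :
    h x ≤ ballMean μ r h x :=
  le_ballMean_of_le_sphereMean μ hh hr fun t ht htr =>
    hs x t ht ((closedBall_subset_closedBall htr).trans hx)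

/-- The source of all compactness below: an integral bound becomes a pointwise bound depending only
on the room around `x` in `Y`. -/
theorem SphereSubmean.le_div_measure [Nontrivial E] {Y : Set E} {h : E → ℝ≥0∞} (hh : Measurable h)
    (hs : SphereSubmean μ Y h) {B : ℝ≥0∞} (hB : ∫⁻ y, h y ∂μ ≤ B)
    {x : E} {r : ℝ} (hr : 0 < r) (hx : closedBall x r ⊆ Y) :
    h x ≤ B / μ (closedBall 0 r) := by
  refine (hs.le_ballMean μ hh hr hx).trans ?_
  rw [ballMean_eq_div]
  exact ENNReal.div_le_div_right ((setLIntegral_le_lintegral _ _).trans hB) _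

theorem exists_bound_of_isCompact [Nontrivial E] {Y : Set E} (hY : IsOpen Y) {B : ℝ≥0∞}
    (hB : B ≠ ∞) {K : Set E} (hK : IsCompact K) (hKY : K ⊆ Y) :
    ∃ C ≠ ∞, ∀ h : E → ℝ≥0∞, Measurable h → SphereSubmean μ Y h → ∫⁻ y, h y ∂μ ≤ B →
      ∀ y ∈ K, h y ≤ C := by
  obtain ⟨δ, hδ, h⟩ := hK.exists_cthickening_subset_open hY hKY
  refine ⟨B / μ (closedBall 0 δ), ENNReal.div_ne_top hB (measure_closedBall_ne_zero μ 0 hδ),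
    fun f hf hs hfB y hy => hs.le_div_measure μ hf hfB hδ ?_⟩
  exact (closedBall_subset_cthickening hy δ).trans h

/-- The upper limit, as the radius tends to `0`, of the ball means of `Φ`. -/
noncomputable def limitMean (Φ : E → ℝ≥0∞) (x : E) : ℝ≥0∞ :=
  limsup (fun s => ballMean μ s Φ x) (𝓝[>] 0)

theorem eventually_ballMean_le {h : E → ℝ≥0∞} (hc : Continuous h) {x : E} {c : ℝ≥0∞}
    (hx : h x < c) : ∀ᶠ s in 𝓝[>] (0 : ℝ), ballMean μ s h x ≤ c := by
  obtain ⟨δ, hδ, hball⟩ := nhds_basis_closedBall.mem_iff.1 (hc.continuousAt.eventually_lt_const hx)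
  filter_upwards [Ioc_mem_nhdsGT hδ] with s hs
  exact ballMean_le_const μ hs.1 fun y hy =>
    (hball (closedBall_subset_closedBall hs.2 hy)).le

variable {Y : Set E} {G : ℕ → E → ℝ≥0∞} {Φ : E → ℝ≥0∞} {B : ℝ≥0∞}

/-- `Φ` is an almost everywhere limit, so no pointwise inequality passes to it directly. Averaged
inequalities between the `G n` do pass, by dominated convergence with the uniform bound on a compact
ball. -/
theorem ballMean_le_ballMean_ballMean [Nontrivial E] (hY : IsOpen Y) (hG : ∀ n, Measurable (G n))
    (hs : ∀ n, SphereSubmean μ Y (G n)) (hB : B ≠ ∞) (hGB : ∀ n, ∫⁻ y, G n y ∂μ ≤ B)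
    (hlim : ∀ᵐ y ∂μ, Tendsto (fun n => G n y) atTop (𝓝 (Φ y)))
    {x : E} {r s : ℝ} (hr : 0 < r) (hs' : 0 < s) (hx : closedBall x (r + s) ⊆ Y) :
    ballMean μ s Φ x ≤ ballMean μ s (ballMean μ r Φ) x := by
  obtain ⟨C, hC, hGC⟩ := exists_bound_of_isCompact μ hY hB (isCompact_closedBall x (r + s)) hx
  have hGC' (n) : ∀ y ∈ closedBall x (r + s), G n y ≤ C := hGC (G n) (hG n) (hs n) (hGB n)
  have hsub {y : E} (hy : y ∈ closedBall x s) : closedBall y r ⊆ closedBall x (r + s) :=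
    closedBall_subset_closedBall' (by rw [mem_closedBall] at hy; linarith)
  have h1 : Tendsto (fun n => ballMean μ s (G n) x) atTop (𝓝 (ballMean μ s Φ x)) :=
    tendsto_ballMean μ hG hlim hs' hC fun n y hy =>
      hGC' n y (closedBall_subset_closedBall (by linarith) hy)
  have h2 : Tendsto (fun n => ballMean μ s (ballMean μ r (G n)) x) atTop
      (𝓝 (ballMean μ s (ballMean μ r Φ) x)) := by
    simp only [ballMean_eq_div μ s]
    refine ENNReal.Tendsto.div_const ?_ (.inr (measure_closedBall_ne_zero μ 0 hs'))
    refine tendsto_lintegral_of_dominated_convergence (fun _ => C)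
      (fun n => (continuous_ballMean μ (hG n) ((hGB n).trans_lt hB.lt_top).ne hr).measurable)
      (fun n => (ae_restrict_iff' measurableSet_closedBall).2 (.of_forall fun y hy => ?_)) ?_
      ((ae_restrict_iff' measurableSet_closedBall).2 (.of_forall fun y hy => ?_))
    · exact ballMean_le_const μ hr fun z hz => hGC' n z (hsub hy hz)
    · rw [setLIntegral_const]
      exact ENNReal.mul_ne_top hC (measure_closedBall_ne_top μ x s)
    · exact tendsto_ballMean μ hG hlim hr hC fun n z hz => hGC' n z (hsub hy hz)
  refine le_of_tendsto_of_tendsto' h1 h2 fun n => ballMean_le_ballMean μ fun y hy => ?_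
  exact (hs n).le_ballMean μ (hG n) hr ((hsub hy).trans hx)

theorem ballMean_le_sphereMean_ballMean_of_tendsto [Nontrivial E] (hY : IsOpen Y)
    (hG : ∀ n, Measurable (G n)) (hs : ∀ n, SphereSubmean μ Y (G n)) (hB : B ≠ ∞)
    (hGB : ∀ n, ∫⁻ y, G n y ∂μ ≤ B)
    (hlim : ∀ᵐ y ∂μ, Tendsto (fun n => G n y) atTop (𝓝 (Φ y)))
    {x : E} {r s : ℝ} (hr : 0 < r) (hs' : 0 < s) (hx : closedBall x (r + s) ⊆ Y) :
    ballMean μ s Φ x ≤ sphereMean μ r (ballMean μ s Φ) x := by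
  obtain ⟨C, hC, hGC⟩ := exists_bound_of_isCompact μ hY hB (isCompact_closedBall x (r + s)) hx
  have hGC' (n) : ∀ y ∈ closedBall x (r + s), G n y ≤ C := hGC (G n) (hG n) (hs n) (hGB n)
  have hsub (θ : sphere (0 : E) 1) : closedBall (x + r • (θ : E)) s ⊆ closedBall x (r + s) :=
    closedBall_subset_closedBall' (by simp [norm_smul, abs_of_pos hr, add_comm])
  have h1 : Tendsto (fun n => ballMean μ s (G n) x) atTop (𝓝 (ballMean μ s Φ x)) :=
    tendsto_ballMean μ hG hlim hs' hC fun n y hy =>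
      hGC' n y (closedBall_subset_closedBall (by linarith) hy)
  have h2 : Tendsto (fun n => sphereMean μ r (ballMean μ s (G n)) x) atTop
      (𝓝 (sphereMean μ r (ballMean μ s Φ) x)) := by
    simp only [sphereMean, laverage_eq]
    refine ENNReal.Tendsto.div_const ?_ (.inr (Measure.measure_univ_ne_zero.2 μ.toSphere_ne_zero))
    refine tendsto_lintegral_of_dominated_convergence (fun _ => C)
      (fun n => (continuous_ballMean μ (hG n) ((hGB n).trans_lt hB.lt_top).ne hs').measurable.comp
        (by fun_prop)) (fun n => .of_forall fun θ => ?_) ?_ (.of_forall fun θ => ?_)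
    · exact ballMean_le_const μ hs' fun z hz => hGC' n z (hsub θ hz)
    · rw [lintegral_const]
      exact ENNReal.mul_ne_top hC (measure_ne_top _ _)
    · exact tendsto_ballMean μ hG hlim hs' hC fun n z hz => hGC' n z (hsub θ hz)
  refine le_of_tendsto_of_tendsto' h1 h2 fun n => ballMean_le_sphereMean_ballMean μ (hG n)
    fun z hz => hs n _ r hr ?_
  refine (closedBall_subset_closedBall' ?_).trans hx
  simpa [add_comm] using hz

/-- Let `s` tend to `0` in `ballMean_le_ballMean_ballMean`: the outer mean disappears because the
inner one is continuous in its centre. -/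
theorem limitMean_le_ballMean [Nontrivial E] (hY : IsOpen Y) (hG : ∀ n, Measurable (G n))
    (hs : ∀ n, SphereSubmean μ Y (G n)) (hB : B ≠ ∞) (hGB : ∀ n, ∫⁻ y, G n y ∂μ ≤ B)
    (hlim : ∀ᵐ y ∂μ, Tendsto (fun n => G n y) atTop (𝓝 (Φ y))) (hΦ : Measurable Φ)
    (hΦfin : ∫⁻ y, Φ y ∂μ ≠ ∞) {x : E} {r : ℝ} (hr : 0 < r) (hx : closedBall x r ⊆ Y) :
    limitMean μ Φ x ≤ ballMean μ r Φ x := by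
  obtain ⟨δ, hδ, hxδ⟩ := exists_closedBall_add_subset hY hr.le hx
  refine le_of_forall_gt fun c hc => ?_
  obtain ⟨c', hc1, hc2⟩ := exists_between hc
  refine lt_of_le_of_lt (limsup_le_of_le (by isBoundedDefault) ?_) hc2
  filter_upwards [eventually_ballMean_le μ (continuous_ballMean μ hΦ hΦfin hr) hc1,
    Ioc_mem_nhdsGT hδ] with s hs1 hs2
  exact (ballMean_le_ballMean_ballMean μ hY hG hs hB hGB hlim hr hs2.1
    ((closedBall_subset_closedBall (by linarith [hs2.2])).trans hxδ)).trans hs1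

theorem limsup_le_limitMean [Nontrivial E] (hY : IsOpen Y) (hG : ∀ n, Measurable (G n))
    (hs : ∀ n, SphereSubmean μ Y (G n)) (hB : B ≠ ∞) (hGB : ∀ n, ∫⁻ y, G n y ∂μ ≤ B)
    (hlim : ∀ᵐ y ∂μ, Tendsto (fun n => G n y) atTop (𝓝 (Φ y))) {x : E} (hx : x ∈ Y) :
    limsup (fun n => G n x) atTop ≤ limitMean μ Φ x := by
  obtain ⟨δ, hδ, hxδ⟩ := exists_closedBall_subset hY hx
  refine le_limsup_of_frequently_le (Eventually.frequently ?_) (by isBoundedDefault)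
  filter_upwards [Ioc_mem_nhdsGT hδ] with s hsδ
  have hsY := (closedBall_subset_closedBall hsδ.2).trans hxδ
  obtain ⟨C, hC, hGC⟩ := exists_bound_of_isCompact μ hY hB (isCompact_closedBall x s) hsY
  have h1 := tendsto_ballMean μ hG hlim hsδ.1 hC fun n y hy =>
    hGC (G n) (hG n) (hs n) (hGB n) y hy
  rw [← h1.limsup_eq]
  exact limsup_le_limsup (.of_forall fun n => (hs n).le_ballMean μ (hG n) hsδ.1 hsY)

theorem exists_bound_limitMean [Nontrivial E] (hY : IsOpen Y) (hG : ∀ n, Measurable (G n))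
    (hs : ∀ n, SphereSubmean μ Y (G n)) (hB : B ≠ ∞) (hGB : ∀ n, ∫⁻ y, G n y ∂μ ≤ B)
    (hlim : ∀ᵐ y ∂μ, Tendsto (fun n => G n y) atTop (𝓝 (Φ y))) (hΦ : Measurable Φ)
    (hΦfin : ∫⁻ y, Φ y ∂μ ≠ ∞) {K : Set E} (hK : IsCompact K) (hKY : K ⊆ Y) :
    ∃ C ≠ ∞, ∀ x ∈ K, limitMean μ Φ x ≤ C := by
  obtain ⟨δ, hδ, h⟩ := hK.exists_cthickening_subset_open hY hKY
  refine ⟨(∫⁻ y, Φ y ∂μ) / μ (closedBall 0 δ),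
    ENNReal.div_ne_top hΦfin (measure_closedBall_ne_zero μ 0 hδ), fun x hx => ?_⟩
  refine (limitMean_le_ballMean μ hY hG hs hB hGB hlim hΦ hΦfin hδ
    ((closedBall_subset_cthickening hx δ).trans h)).trans ?_
  rw [ballMean_eq_div]
  exact ENNReal.div_le_div_right (setLIntegral_le_lintegral _ _) _

/-- One ball mean at `x` lies below `c`; it is continuous in the centre and dominates `limitMean`
nearby. -/
theorem upperSemicontinuousOn_limitMean [Nontrivial E] (hY : IsOpen Y) (hG : ∀ n, Measurable (G n))
    (hs : ∀ n, SphereSubmean μ Y (G n)) (hB : B ≠ ∞) (hGB : ∀ n, ∫⁻ y, G n y ∂μ ≤ B)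
    (hlim : ∀ᵐ y ∂μ, Tendsto (fun n => G n y) atTop (𝓝 (Φ y))) (hΦ : Measurable Φ)
    (hΦfin : ∫⁻ y, Φ y ∂μ ≠ ∞) : UpperSemicontinuousOn (limitMean μ Φ) Y := by
  intro x hx c hc
  obtain ⟨δ, hδ, hxδ⟩ := exists_closedBall_subset hY hx
  obtain ⟨s, hs1, hs2⟩ := ((eventually_lt_of_limsup_lt hc).and
    (Ioc_mem_nhdsGT (half_pos hδ))).exists
  refine mem_nhdsWithin_of_mem_nhds ?_
  filter_upwards [(continuous_ballMean μ hΦ hΦfin hs2.1).continuousAt.eventually_lt_const hs1,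
    closedBall_mem_nhds x (half_pos hδ)] with y hy1 hy2
  refine (limitMean_le_ballMean μ hY hG hs hB hGB hlim hΦ hΦfin hs2.1 ?_).trans_lt hy1
  refine (closedBall_subset_closedBall' ?_).trans hxδ
  linarith [hs2.2, mem_closedBall.1 hy2]

/-- The ball means of `Φ` satisfy the sphere inequality; the reverse Fatou lemma on the sphere
carries it to their upper limit along radii `u n` tending to `0`. -/
theorem sphereSubmean_limitMean [Nontrivial E] (hY : IsOpen Y) (hG : ∀ n, Measurable (G n))
    (hs : ∀ n, SphereSubmean μ Y (G n)) (hB : B ≠ ∞) (hGB : ∀ n, ∫⁻ y, G n y ∂μ ≤ B)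
    (hlim : ∀ᵐ y ∂μ, Tendsto (fun n => G n y) atTop (𝓝 (Φ y))) (hΦ : Measurable Φ)
    (hΦfin : ∫⁻ y, Φ y ∂μ ≠ ∞) : SphereSubmean μ Y (limitMean μ Φ) := by
  intro x r hr hx
  obtain ⟨δ, hδ, hxδ⟩ := exists_closedBall_add_subset hY hr.le hx
  obtain ⟨u, -, hu, hulim⟩ := exists_seq_strictAnti_tendsto' hδ
  have hu0 : Tendsto u atTop (𝓝[>] 0) :=
    tendsto_nhdsWithin_iff.2 ⟨hulim, .of_forall fun n => (hu n).1⟩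
  have huY (n) : closedBall x (r + u n) ⊆ Y :=
    (closedBall_subset_closedBall (by linarith [(hu n).2])).trans hxδ
  have hsub (n) (θ : sphere (0 : E) 1) : closedBall (x + r • (θ : E)) (u n) ⊆
      closedBall x (r + δ) :=
    closedBall_subset_closedBall' (by simp [norm_smul, abs_of_pos hr]; linarith [(hu n).2])
  have h1 (n) : limitMean μ Φ x ≤ sphereMean μ r (ballMean μ (u n) Φ) x :=
    (limitMean_le_ballMean μ hY hG hs hB hGB hlim hΦ hΦfin (hu n).1
      ((closedBall_subset_closedBall (by linarith)).trans (huY n))).trans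
    (ballMean_le_sphereMean_ballMean_of_tendsto μ hY hG hs hB hGB hlim hr (hu n).1 (huY n))
  obtain ⟨C, hC, hGC⟩ := exists_bound_of_isCompact μ hY hB (isCompact_closedBall x (r + δ)) hxδ
  have hΦC (n) (θ : sphere (0 : E) 1) : ballMean μ (u n) Φ (x + r • (θ : E)) ≤ C := by
    refine le_of_tendsto' (tendsto_ballMean μ hG hlim (hu n).1 hC fun k y hy =>
      hGC (G k) (hG k) (hs k) (hGB k) y (hsub n θ hy)) fun k => ?_
    exact ballMean_le_const μ (hu n).1 fun y hy =>
      hGC (G k) (hG k) (hs k) (hGB k) y (hsub n θ hy)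
  have h2 : limsup (fun n => ∫⁻ θ : sphere (0 : E) 1, ballMean μ (u n) Φ (x + r • (θ : E))
      ∂((μ.toSphere univ)⁻¹ • μ.toSphere)) atTop ≤ ∫⁻ θ : sphere (0 : E) 1,
      limsup (fun n => ballMean μ (u n) Φ (x + r • (θ : E))) atTop
      ∂((μ.toSphere univ)⁻¹ • μ.toSphere) := by
    refine limsup_lintegral_le (fun _ => C) (fun n => ?_) (fun n => .of_forall (hΦC n)) ?_
    · exact (continuous_ballMean μ hΦ hΦfin (hu n).1).measurable.comp (by fun_prop)
    · rw [lintegral_const, Measure.smul_apply, smul_eq_mul, ENNReal.inv_mul_cancel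
        (Measure.measure_univ_ne_zero.2 μ.toSphere_ne_zero) (measure_ne_top _ _), mul_one]
      exact hC
  calc limitMean μ Φ x
      ≤ limsup (fun n => sphereMean μ r (ballMean μ (u n) Φ) x) atTop :=
        le_limsup_of_frequently_le (Frequently.of_forall h1) (by isBoundedDefault)
    _ ≤ _ := h2
    _ ≤ sphereMean μ r (limitMean μ Φ) x := by
        refine lintegral_mono fun θ => ?_
        exact hu0.limsup_comp_le_limsup (u := fun s => ballMean μ s Φ (x + r • (θ : E)))

theorem limitMean_ae_eq {h : E → ℝ≥0∞} (hh : Measurable h) (hfin : ∫⁻ y, h y ∂μ ≠ ∞) :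
    limitMean μ h =ᵐ[μ] h := by
  filter_upwards [ae_tendsto_ballMean μ hh hfin] with x hx using hx.limsup_eq

end Limit

/-! ### Convergent sequences from decreasing convex sets. -/

/-- A decreasing sequence of nonempty, midpoint convex, bounded subsets of an inner product space
admits a Cauchy sequence of elements: almost minimizers of the norm. -/
theorem exists_cauchySeq_mem {H : Type*} [NormedAddCommGroup H] [InnerProductSpace ℝ H]
    {S : ℕ → Set H} (hanti : Antitone S) (hne : ∀ n, (S n).Nonempty)
    (hmid : ∀ n, ∀ f ∈ S n, ∀ g ∈ S n, (1 / 2 : ℝ) • (f + g) ∈ S n) {R : ℝ}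
    (hR : ∀ f ∈ S 0, ‖f‖ ≤ R) : ∃ g : ℕ → H, (∀ n, g n ∈ S n) ∧ CauchySeq g := by
  set m : ℕ → ℝ := fun n => sInf (norm '' S n) with hm
  have hbdd (n) : BddBelow (norm '' S n) := ⟨0, by rintro _ ⟨f, -, rfl⟩; exact norm_nonneg f⟩
  have hmle (n) {f : H} (hf : f ∈ S n) : m n ≤ ‖f‖ := csInf_le (hbdd n) ⟨f, hf, rfl⟩
  have hm0 (n) : 0 ≤ m n := Real.sInf_nonneg (by rintro _ ⟨f, -, rfl⟩; exact norm_nonneg f)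
  have hmono : Monotone m := fun a b hab =>
    csInf_le_csInf (hbdd a) ((hne b).image _) (image_mono (hanti hab))
  have hmR (n) : m n ≤ R := by
    obtain ⟨f, hf⟩ := hne n
    exact (hmle n hf).trans (hR f (hanti (Nat.zero_le n) hf))
  have hex (n : ℕ) : ∃ f ∈ S n, ‖f‖ < m n + 1 / ((n : ℝ) + 1) := by
    obtain ⟨_, ⟨f, hf, rfl⟩, h⟩ := exists_lt_of_csInf_lt ((hne n).image norm)
      (show sInf (norm '' S n) < m n + 1 / ((n : ℝ) + 1) from
        lt_add_of_pos_right _ Nat.one_div_pos_of_nat)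
    exact ⟨f, hf, h⟩
  choose g hgS hg using hex
  refine ⟨g, hgS, ?_⟩
  have hbdA : BddAbove (range m) := ⟨R, by rintro _ ⟨n, rfl⟩; exact hmR n⟩
  have hlim : Tendsto m atTop (𝓝 (⨆ n, m n)) := tendsto_atTop_ciSup hmono hbdA
  set L := ⨆ n, m n
  have hmL (n) : m n ≤ L := le_ciSup hbdA n
  -- The parallelogram law: both norms are at most `L + 1 / (N + 1)`, and the midpoint, lying in `S
  -- N`, has norm at least `m N`.
  refine cauchySeq_of_le_tendsto_0 (fun N : ℕ => √(4 * ((L + 1 / ((N : ℝ) + 1)) ^ 2 - m N ^ 2)))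
    (fun n k N hn hk => ?_) ?_
  · have hb (n) (hn : N ≤ n) : ‖g n‖ ≤ L + 1 / ((N : ℝ) + 1) := by
      have := Nat.one_div_le_one_div (α := ℝ) hn
      linarith [hg n, hmL n]
    rw [dist_eq_norm]
    refine Real.le_sqrt_of_sq_le ?_
    have h1 := hmle N (hmid N _ (hanti hn (hgS n)) _ (hanti hk (hgS k)))
    rw [norm_smul, Real.norm_of_nonneg (by norm_num)] at h1
    have h2 := parallelogram_law_with_norm ℝ (g n) (g k)
    have h3 : m N ^ 2 ≤ (1 / 2 * ‖g n + g k‖) ^ 2 := pow_le_pow_left₀ (hm0 N) h1 2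
    have h4 := pow_le_pow_left₀ (norm_nonneg _) (hb n hn) 2
    have h5 := pow_le_pow_left₀ (norm_nonneg _) (hb k hk) 2
    nlinarith
  · have h1 : Tendsto (fun N : ℕ => √(4 * ((L + 1 / ((N : ℝ) + 1)) ^ 2 - m N ^ 2))) atTop
        (𝓝 (√(4 * ((L + 0) ^ 2 - L ^ 2)))) :=
      (Real.continuous_sqrt.tendsto _).comp
        ((((tendsto_const_nhds.add tendsto_one_div_add_atTop_nhds_zero_nat).pow 2).sub
          (hlim.pow 2)).const_mul 4)
    simpa using h1

/-- A decreasing sequence of nonempty, midpoint convex sets of uniformly bounded functions on a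
finite measure space admits an almost everywhere convergent sequence of elements. -/
theorem exists_seq_ae_tendsto {α : Type*} [MeasurableSpace α] {m : Measure α} [IsFiniteMeasure m]
    {A : ℕ → Set (α → ℝ)} (hanti : Antitone A) (hne : ∀ n, (A n).Nonempty)
    (hmid : ∀ n, ∀ f ∈ A n, ∀ g ∈ A n, (fun y => 1 / 2 * (f y + g y)) ∈ A n)
    (hmeas : ∀ f ∈ A 0, AEStronglyMeasurable f m) {C : ℝ} (hC0 : 0 ≤ C)
    (hC : ∀ f ∈ A 0, ∀ᵐ y ∂m, ‖f y‖ ≤ C) :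
    ∃ (f : ℕ → α → ℝ) (φ : α → ℝ), (∀ n, f n ∈ A n) ∧
      ∀ᵐ y ∂m, Tendsto (fun n => f n y) atTop (𝓝 (φ y)) := by
  have hmem {n} {f : α → ℝ} (hf : f ∈ A n) : MemLp f 2 m :=
    MemLp.of_bound (hmeas f (hanti (Nat.zero_le n) hf)) C (hC f (hanti (Nat.zero_le n) hf))
  set S : ℕ → Set (Lp ℝ 2 m) := fun n => {F | ∃ f ∈ A n, F =ᵐ[m] f} with hS
  have hR : ∀ F ∈ S 0, ‖F‖ ≤ (measureUnivNNReal m : ℝ) ^ (2 : ℝ≥0∞).toReal⁻¹ * C := by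
    rintro F ⟨f, hf, hFf⟩
    refine Lp.norm_le_of_ae_bound hC0 ?_
    filter_upwards [hC f hf, hFf] with y h1 h2
    rwa [h2]
  obtain ⟨F, hFS, hF⟩ := exists_cauchySeq_mem (S := S)
    (fun a b hab F ⟨f, hf, h⟩ => ⟨f, hanti hab hf, h⟩)
    (fun n => by
      obtain ⟨f, hf⟩ := hne n
      exact ⟨(hmem hf).toLp f, f, hf, (hmem hf).coeFn_toLp⟩)
    (by
      rintro n F ⟨f, hf, hFf⟩ G ⟨g, hg, hGg⟩
      refine ⟨_, hmid n f hf g hg, ?_⟩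
      filter_upwards [Lp.coeFn_smul (1 / 2 : ℝ) (F + G), Lp.coeFn_add F G, hFf, hGg]
        with y h1 h2 h3 h4
      rw [h1, Pi.smul_apply, h2, Pi.add_apply, h3, h4, smul_eq_mul])
    hR
  obtain ⟨F', hF'⟩ := cauchySeq_tendsto_of_complete hF
  obtain ⟨ns, hns, hlim⟩ := (tendstoInMeasure_of_tendsto_Lp hF').exists_seq_tendsto_ae
  choose f hfA hf using hFS
  -- Since `n ≤ ns n`, the subsequence still has its `n`-th term in `A n`.
  refine ⟨fun n => f (ns n), F', fun n => hanti (hns.le_apply) (hfA _), ?_⟩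
  filter_upwards [hlim, ae_all_iff.2 fun n => hf (ns n)] with y h1 h2
  simpa only [h2] using h1

/-! ### Real-valued subharmonic functions and the dual class. -/

theorem add_smul_mem_of_closedBall_subset {U : Set (Space d)} {x : Space d} {r : ℝ} (hr : 0 < r)
    (hx : closedBall x r ⊆ U) (θ : sphere (0 : Space d) 1) : x + r • (θ : Space d) ∈ U :=
  hx (by simp [norm_smul, abs_of_pos hr])

theorem IsSubharmonicOn.sphereSubmean {ψ : Space d → ℝ} {U : Set (Space d)}
    (hψ : IsSubharmonicOn ψ U) (h0 : ∀ y ∈ U, 0 ≤ ψ y) :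
    SphereSubmean volume U (U.indicator fun y => ENNReal.ofReal (ψ y)) := by
  intro x r hr hx
  obtain ⟨hint, hle⟩ := hψ.2 x r hr hx
  have hmem := add_smul_mem_of_closedBall_subset hr hx
  rw [indicator_of_mem (hx (mem_closedBall_self hr.le)), sphereMean]
  simp only [indicator_of_mem (hmem _)]
  refine (ENNReal.ofReal_le_ofReal hle).trans (le_of_eq ?_)
  rw [average, laverage, ofReal_integral_eq_lintegral_ofReal]
  -- Surface measure vanishes in dimension `0`, which is not excluded here; both means are then `0`.
  · by_cases h : (volume : Measure (Space d)).toSphere univ = 0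
    · rw [Measure.measure_univ_eq_zero.1 h]
      simp
    · exact hint.smul_measure (ENNReal.inv_ne_top.2 h)
  · exact .of_forall fun θ => h0 _ (hmem θ)

theorem upperSemicontinuousOn_toReal {U : Set (Space d)} {h : Space d → ℝ≥0∞}
    (husc : UpperSemicontinuousOn h U) (hfin : ∀ x ∈ U, h x ≠ ∞) :
    UpperSemicontinuousOn (fun y => (h y).toReal) U := by
  intro x hx c hc
  have hc' : h x < ENNReal.ofReal c := (ENNReal.lt_ofReal_iff_toReal_lt (hfin x hx)).2 hc
  filter_upwards [husc x hx _ hc'] with y hy using ENNReal.toReal_lt_of_lt_ofReal hy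

theorem isSubharmonicOn_toReal {U : Set (Space d)} {h : Space d → ℝ≥0∞}
    (husc : UpperSemicontinuousOn h U) (hs : SphereSubmean volume U h)
    (hfin : ∀ K : Set (Space d), IsCompact K → K ⊆ U → ∃ C ≠ ∞, ∀ x ∈ K, h x ≤ C) :
    IsSubharmonicOn (fun y => (h y).toReal) U := by
  have hfin' : ∀ x ∈ U, h x ≠ ∞ := fun x hx => by
    obtain ⟨C, hC, hle⟩ := hfin {x} isCompact_singleton (singleton_subset_iff.2 hx)
    exact ((hle x rfl).trans_lt hC.lt_top).ne
  refine ⟨upperSemicontinuousOn_toReal husc hfin', fun x r hr hx => ?_⟩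
  have hmem := add_smul_mem_of_closedBall_subset hr hx
  obtain ⟨C, hC, hle⟩ := hfin _ (isCompact_closedBall x r) hx
  have hle' (θ : sphere (0 : Space d) 1) : h (x + r • (θ : Space d)) ≤ C :=
    hle _ (by simp [norm_smul, abs_of_pos hr])
  have husc' : UpperSemicontinuous fun θ : sphere (0 : Space d) 1 => h (x + r • (θ : Space d)) := by
    intro θ c hc
    have hcont : Continuous fun θ : sphere (0 : Space d) 1 => x + r • (θ : Space d) := by fun_prop
    have h1 : Tendsto (fun θ : sphere (0 : Space d) 1 => x + r • (θ : Space d)) (𝓝 θ)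
        (𝓝[U] (x + r • (θ : Space d))) :=
      tendsto_nhdsWithin_iff.2 ⟨hcont.tendsto θ, .of_forall hmem⟩
    exact h1.eventually (husc _ (hmem θ) c hc)
  have hmeas := husc'.measurable
  refine ⟨?_, ?_⟩
  · refine Integrable.of_bound hmeas.ennreal_toReal.aestronglyMeasurable C.toReal
      (.of_forall fun θ => ?_)
    rw [Real.norm_of_nonneg ENNReal.toReal_nonneg]
    exact ENNReal.toReal_mono hC (hle' θ)
  · rw [← toReal_laverage hmeas.aemeasurable (.of_forall fun θ => hfin' _ (hmem θ))]
    refine ENNReal.toReal_mono (laverage_lt_top ?_).ne (hs x r hr hx)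
    refine ((lintegral_mono hle').trans_lt ?_).ne
    rw [lintegral_const]
    exact ENNReal.mul_lt_top hC.lt_top (measure_lt_top _ _)

/-- The class over which the dual value is the supremum. -/
abbrev DualClass (Y : Set (Space d)) : Set (Space d → ℝ) :=
  SubharmonicBddBelow Y ∩ BoundedContinuousOn Y

theorem bddBelow_of_boundedContinuousOn {Y : Set (Space d)} {ψ : Space d → ℝ}
    (h : ψ ∈ BoundedContinuousOn Y) : BddBelow (ψ '' Y) := by
  obtain ⟨-, C, hC⟩ := h
  exact ⟨-C, by rintro _ ⟨y, hy, rfl⟩; exact (abs_le.1 (hC y hy)).1⟩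

theorem mem_dualClass {Y : Set (Space d)} {ψ : Space d → ℝ} (h : IsSubharmonicOn ψ Y)
    (hb : ψ ∈ BoundedContinuousOn Y) : ψ ∈ DualClass Y :=
  ⟨⟨h, bddBelow_of_boundedContinuousOn hb⟩, hb⟩

theorem IsSubharmonicOn.add_mul {Y : Set (Space d)} {f g : Space d → ℝ}
    (hf : IsSubharmonicOn f Y) (hg : IsSubharmonicOn g Y) (hfc : ContinuousOn f Y)
    (hgc : ContinuousOn g Y) {a b : ℝ} (ha : 0 ≤ a) (hb : 0 ≤ b) :
    IsSubharmonicOn (fun y => a * f y + b * g y) Y := by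
  refine ⟨((hfc.const_mul a).add (hgc.const_mul b)).upperSemicontinuousOn,
    fun x r hr hx => ?_⟩
  obtain ⟨hf1, hf2⟩ := hf.2 x r hr hx
  obtain ⟨hg1, hg2⟩ := hg.2 x r hr hx
  refine ⟨(hf1.const_mul a).add (hg1.const_mul b), ?_⟩
  rw [average_eq] at hf2 hg2 ⊢
  rw [integral_add (hf1.const_mul a) (hg1.const_mul b), integral_const_mul, integral_const_mul]
  simp only [smul_eq_mul] at *
  nlinarith [mul_le_mul_of_nonneg_left hf2 ha, mul_le_mul_of_nonneg_left hg2 hb]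

theorem dualClass_add_mul {Y : Set (Space d)} {f g : Space d → ℝ} (hf : f ∈ DualClass Y)
    (hg : g ∈ DualClass Y) {a b : ℝ} (ha : 0 ≤ a) (hb : 0 ≤ b) :
    (fun y => a * f y + b * g y) ∈ DualClass Y := by
  obtain ⟨⟨hfs, -⟩, hfc, A, hA⟩ := hf
  obtain ⟨⟨hgs, -⟩, hgc, B, hB⟩ := hg
  refine mem_dualClass (hfs.add_mul hgs hfc hgc ha hb)
    ⟨(hfc.const_mul a).add (hgc.const_mul b), a * A + b * B, fun y hy => ?_⟩
  refine (abs_add_le _ _).trans ?_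
  rw [abs_mul, abs_mul, abs_of_nonneg ha, abs_of_nonneg hb]
  exact add_le_add (mul_le_mul_of_nonneg_left (hA y hy) ha)
    (mul_le_mul_of_nonneg_left (hB y hy) hb)

theorem const_mem_dualClass (hd : 1 ≤ d) (Y : Set (Space d)) (c : ℝ) :
    (fun _ => c) ∈ DualClass Y := by
  have : Nonempty (Fin d) := ⟨⟨0, hd⟩⟩
  have : NeZero (volume : Measure (Space d)).toSphere := ⟨Measure.toSphere_ne_zero _⟩
  refine mem_dualClass ⟨continuousOn_const.upperSemicontinuousOn, fun x r hr hx => ?_⟩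
    ⟨continuousOn_const, |c|, fun y _ => le_rfl⟩
  exact ⟨integrable_const c, by rw [average_const]⟩

/-! ### The quadratic transform -/

theorem bddBelow_range_quad {Y : Set (Space d)} {ψ : Space d → ℝ} (h : BddBelow (ψ '' Y))
    (x : Space d) : BddBelow (range fun y : Y => ψ y + ‖x - y‖ ^ 2) := by
  obtain ⟨c, hc⟩ := h
  refine ⟨c, ?_⟩
  rintro _ ⟨y, rfl⟩
  have := hc (mem_image_of_mem ψ y.2)
  simp only
  nlinarith [sq_nonneg ‖x - (y : Space d)‖]

theorem quadTransform_le {Y : Set (Space d)} {ψ : Space d → ℝ} (h : BddBelow (ψ '' Y))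
    (x : Space d) {y : Space d} (hy : y ∈ Y) : quadTransform Y ψ x ≤ ψ y + ‖x - y‖ ^ 2 :=
  ciInf_le (bddBelow_range_quad h x) ⟨y, hy⟩

theorem le_quadTransform {Y : Set (Space d)} (hY : Y.Nonempty) {ψ : Space d → ℝ} {x : Space d}
    {c : ℝ} (h : ∀ y ∈ Y, c ≤ ψ y + ‖x - y‖ ^ 2) : c ≤ quadTransform Y ψ x := by
  have := hY.to_subtype
  exact le_ciInf fun y => h y y.2

theorem le_quadTransform_of_le {Y : Set (Space d)} (hY : Y.Nonempty) {ψ : Space d → ℝ}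
    {x : Space d} {c : ℝ} (h : ∀ y ∈ Y, c ≤ ψ y) : c ≤ quadTransform Y ψ x :=
  le_quadTransform hY fun y hy => by nlinarith [h y hy, sq_nonneg ‖x - y‖]

theorem measurable_quadTransform {Y : Set (Space d)} {ψ : Space d → ℝ} (h : BddBelow (ψ '' Y)) :
    Measurable (quadTransform Y ψ) := by
  refine (upperSemicontinuous_ciInf (bddBelow_range_quad h) fun y => ?_).measurable
  exact Continuous.upperSemicontinuous (by fun_prop)

theorem quadTransform_add_mul_le {Y : Set (Space d)} (hY : Y.Nonempty) {f g : Space d → ℝ}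
    (hf : BddBelow (f '' Y)) (hg : BddBelow (g '' Y)) {a b : ℝ} (ha : 0 ≤ a) (hb : 0 ≤ b)
    (hab : a + b = 1) (x : Space d) :
    a * quadTransform Y f x + b * quadTransform Y g x
      ≤ quadTransform Y (fun y => a * f y + b * g y) x := by
  refine le_quadTransform hY fun y hy => ?_
  have h1 := mul_le_mul_of_nonneg_left (quadTransform_le hf x hy) ha
  have h2 := mul_le_mul_of_nonneg_left (quadTransform_le hg x hy) hb
  have : ‖x - y‖ ^ 2 = a * ‖x - y‖ ^ 2 + b * ‖x - y‖ ^ 2 := by rw [← add_mul, hab, one_mul]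
  linarith

theorem quadTransform_sub_const {Y : Set (Space d)} (hY : Y.Nonempty) {f : Space d → ℝ}
    (hf : BddBelow (f '' Y)) (c : ℝ) (x : Space d) :
    quadTransform Y f x - c ≤ quadTransform Y (fun y => f y - c) x :=
  le_quadTransform hY fun y hy => by linarith [quadTransform_le hf x hy]

theorem exists_bound_normSq_sub {X Y : Set (Space d)} (hX : Bornology.IsBounded X)
    (hY : Bornology.IsBounded Y) : ∃ M, 0 ≤ M ∧ ∀ x ∈ X, ∀ y ∈ Y, ‖x - y‖ ^ 2 ≤ M := by
  obtain ⟨R, hR⟩ := hX.exists_norm_le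
  obtain ⟨S, hS⟩ := hY.exists_norm_le
  refine ⟨(|R| + |S|) ^ 2, sq_nonneg _, fun x hx y hy => ?_⟩
  refine pow_le_pow_left₀ (norm_nonneg _) ((norm_sub_le x y).trans ?_) 2
  exact add_le_add ((hR x hx).trans (le_abs_self R)) ((hS y hy).trans (le_abs_self S))

theorem integrableOn_quadTransform {X Y : Set (Space d)} (hXm : MeasurableSet X)
    (hX : Bornology.IsBounded X) (hY : Bornology.IsBounded Y) (hYne : Y.Nonempty)
    {μ : Measure (Space d)} [IsFiniteMeasure μ] {ψ : Space d → ℝ} (h : BddBelow (ψ '' Y)) :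
    IntegrableOn (quadTransform Y ψ) X μ := by
  obtain ⟨M, -, hM⟩ := exists_bound_normSq_sub hX hY
  obtain ⟨y, hy⟩ := hYne
  obtain ⟨c, hc⟩ := id h
  refine Measure.integrableOn_of_bounded (M := max |c| |ψ y + M|) (measure_ne_top _ _)
    (measurable_quadTransform h).aestronglyMeasurable
    ((ae_restrict_iff' hXm).2 (.of_forall fun x hx => ?_))
  refine abs_le_max_abs_abs (le_quadTransform_of_le ⟨y, hy⟩ fun z hz => hc ⟨z, hz, rfl⟩)
    ((quadTransform_le h x hy).trans (by linarith [hM x hx y hy]))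

theorem integrableOn_of_boundedContinuousOn {Y : Set (Space d)} (hY : MeasurableSet Y)
    {ν : Measure (Space d)} [IsFiniteMeasure ν] {ψ : Space d → ℝ}
    (h : ψ ∈ BoundedContinuousOn Y) : IntegrableOn ψ Y ν := by
  obtain ⟨hc, C, hC⟩ := h
  exact Integrable.of_bound (hc.aestronglyMeasurable hY) C ((ae_restrict_iff' hY).2 (.of_forall hC))

theorem IsProbOn.restrict_eq {U : Set (Space d)} {μ : Measure (Space d)} (h : IsProbOn U μ) :
    μ.restrict U = μ :=
  Measure.restrict_eq_self_of_ae_mem (mem_ae_iff.2 h.2)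

theorem IsProbOn.nonempty {U : Set (Space d)} {μ : Measure (Space d)} (h : IsProbOn U μ) :
    U.Nonempty := by
  have := h.1
  rw [nonempty_iff_ne_empty]
  rintro rfl
  simpa using h.2

/-! ### Bounds, concavity and normalization for the dual functional. -/

/-- Integrate `Q₂(ψ)(x) ≤ ψ(y) + M` in `y` against `ν`, then in `x` against `μ`. -/
theorem dualFunctional_le {X Y : Set (Space d)} (hXo : IsOpen X) (hYo : IsOpen Y)
    (hXb : Bornology.IsBounded X) (hYb : Bornology.IsBounded Y) {μ ν : Measure (Space d)}
    (hμ : IsProbOn X μ) (hν : IsProbOn Y ν) {M : ℝ} (hM : ∀ x ∈ X, ∀ y ∈ Y, ‖x - y‖ ^ 2 ≤ M)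
    {ψ : Space d → ℝ} (hψ : BddBelow (ψ '' Y)) (hψi : IntegrableOn ψ Y ν) :
    dualFunctional X Y μ ν ψ ≤ M := by
  have := hμ.1
  have := hν.1
  have h1 : ∀ x ∈ X, quadTransform Y ψ x ≤ ∫ y in Y, ψ y ∂ν + M := by
    intro x hx
    have h2 : ∫ _y in Y, (quadTransform Y ψ x - M) ∂ν ≤ ∫ y in Y, ψ y ∂ν := by
      refine setIntegral_mono_on integrableOn_const hψi hYo.measurableSet fun y hy => ?_
      linarith [quadTransform_le hψ x hy, hM x hx y hy]
    rw [hν.restrict_eq] at h2 ⊢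
    rw [integral_const, probReal_univ, one_smul] at h2
    linarith
  have h3 := setIntegral_mono_on (integrableOn_quadTransform hXo.measurableSet hXb hYb hν.nonempty
    (μ := μ) hψ) integrableOn_const hXo.measurableSet h1
  rw [dualFunctional]
  rw [hμ.restrict_eq] at h3 ⊢
  rw [integral_const, probReal_univ, one_smul] at h3
  linarith

theorem exists_dualValue_eq (hd : 1 ≤ d) {X Y : Set (Space d)} (hXo : IsOpen X) (hYo : IsOpen Y)
    (hXb : Bornology.IsBounded X) (hYb : Bornology.IsBounded Y) {μ ν : Measure (Space d)}
    (hμ : IsProbOn X μ) (hν : IsProbOn Y ν) :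
    ∃ D : ℝ, dualValue X Y μ ν = D ∧ (∀ ψ ∈ DualClass Y, dualFunctional X Y μ ν ψ ≤ D) ∧
      ∀ ε > 0, ∃ ψ ∈ DualClass Y, D - ε < dualFunctional X Y μ ν ψ := by
  have := hν.1
  obtain ⟨M, -, hM⟩ := exists_bound_normSq_sub hXb hYb
  have hle : dualValue X Y μ ν ≤ M := iSup₂_le fun ψ hψ => EReal.coe_le_coe_iff.2 <|
    dualFunctional_le hXo hYo hXb hYb hμ hν hM hψ.1.2
      (integrableOn_of_boundedContinuousOn hYo.measurableSet hψ.2)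
  have hge (ψ) (hψ : ψ ∈ DualClass Y) : (dualFunctional X Y μ ν ψ : EReal) ≤ dualValue X Y μ ν :=
    le_iSup₂_of_le ψ hψ le_rfl
  have htop : dualValue X Y μ ν ≠ ⊤ := (hle.trans_lt (EReal.coe_lt_top M)).ne
  have hbot : dualValue X Y μ ν ≠ ⊥ :=
    ((EReal.bot_lt_coe _).trans_le (hge _ (const_mem_dualClass hd Y 0))).ne'
  have hD := EReal.coe_toReal htop hbot
  refine ⟨(dualValue X Y μ ν).toReal, hD.symm, fun ψ hψ => ?_, fun ε hε => ?_⟩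
  · rw [← EReal.coe_le_coe_iff, hD]
    exact hge ψ hψ
  · have h1 : (((dualValue X Y μ ν).toReal - ε : ℝ) : EReal) < dualValue X Y μ ν := by
      conv_rhs => rw [← hD]
      exact EReal.coe_lt_coe_iff.2 (by linarith)
    obtain ⟨ψ, hψ⟩ := lt_iSup_iff.1 h1
    obtain ⟨hψm, hψ⟩ := lt_iSup_iff.1 hψ
    exact ⟨ψ, hψm, EReal.coe_lt_coe_iff.1 hψ⟩

theorem add_mul_dualFunctional_le {X Y : Set (Space d)} (hXo : IsOpen X) (hYo : IsOpen Y)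
    (hXb : Bornology.IsBounded X) (hYb : Bornology.IsBounded Y) {μ ν : Measure (Space d)}
    (hμ : IsProbOn X μ) (hν : IsProbOn Y ν) {f g : Space d → ℝ} (hf : f ∈ DualClass Y)
    (hg : g ∈ DualClass Y) {a b : ℝ} (ha : 0 ≤ a) (hb : 0 ≤ b) (hab : a + b = 1) :
    a * dualFunctional X Y μ ν f + b * dualFunctional X Y μ ν g
      ≤ dualFunctional X Y μ ν (fun y => a * f y + b * g y) := by
  have := hμ.1
  have := hν.1
  have hY := hν.nonempty
  have hfi := integrableOn_of_boundedContinuousOn hYo.measurableSet hf.2 (ν := ν)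
  have hgi := integrableOn_of_boundedContinuousOn hYo.measurableSet hg.2 (ν := ν)
  have hq (h) (hh : h ∈ DualClass Y) : IntegrableOn (quadTransform Y h) X μ :=
    integrableOn_quadTransform hXo.measurableSet hXb hYb hY hh.1.2
  have h1 := integral_mono (((hq f hf).const_mul a).add ((hq g hg).const_mul b))
    (hq _ (dualClass_add_mul hf hg ha hb))
    fun x => quadTransform_add_mul_le hY hf.1.2 hg.1.2 ha hb hab x
  have h2 := integral_add ((hq f hf).const_mul a) ((hq g hg).const_mul b)
  simp only [Pi.add_apply] at h1
  rw [h2, integral_const_mul, integral_const_mul] at h1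
  simp only [dualFunctional]
  rw [integral_add (hfi.const_mul a) (hgi.const_mul b), integral_const_mul, integral_const_mul]
  linarith

/-- Subtracting its infimum, one may replace a function of the dual class by a nonnegative one whose
integral is controlled, without decreasing the dual functional. -/
theorem exists_nonneg_dualFunctional_ge (hd : 1 ≤ d) {X Y : Set (Space d)} (hXo : IsOpen X)
    (hYo : IsOpen Y) (hXb : Bornology.IsBounded X) (hYb : Bornology.IsBounded Y)
    {μ ν : Measure (Space d)} (hμ : IsProbOn X μ) (hν : IsProbOn Y ν) {M : ℝ}
    (hM : ∀ x ∈ X, ∀ y ∈ Y, ‖x - y‖ ^ 2 ≤ M) {ψ : Space d → ℝ} (hψ : ψ ∈ DualClass Y) :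
    ∃ f ∈ DualClass Y, (∀ y ∈ Y, 0 ≤ f y) ∧
      dualFunctional X Y μ ν ψ ≤ dualFunctional X Y μ ν f ∧
      ∫ y in Y, f y ∂ν ≤ M + 1 - dualFunctional X Y μ ν f := by
  have := hμ.1
  have := hν.1
  have hY := hν.nonempty
  set c := sInf (ψ '' Y) with hc
  have hfeq : (fun y => ψ y - c) = fun y => 1 * ψ y + 1 * (-c) := by
    ext y
    ring
  have hfm : (fun y => ψ y - c) ∈ DualClass Y := by
    rw [hfeq]
    exact dualClass_add_mul hψ (const_mem_dualClass hd Y (-c)) zero_le_one zero_le_one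
  have hq (h) (hh : h ∈ DualClass Y) : IntegrableOn (quadTransform Y h) X μ :=
    integrableOn_quadTransform hXo.measurableSet hXb hYb hY hh.1.2
  refine ⟨fun y => ψ y - c, hfm, fun y hy => sub_nonneg.2 (csInf_le hψ.1.2 ⟨y, hy, rfl⟩), ?_, ?_⟩
  · have h1 := integral_mono ((hq ψ hψ).sub (integrable_const c)) (hq _ hfm)
      fun x => quadTransform_sub_const hY hψ.1.2 c x
    have h2 := integral_sub (hq ψ hψ) (integrable_const c)
    simp only [Pi.sub_apply] at h1
    rw [h2] at h1
    have h3 := integral_sub (integrableOn_of_boundedContinuousOn hYo.measurableSet hψ.2 (ν := ν))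
      (integrable_const c)
    simp only [dualFunctional]
    rw [h3]
    rw [hμ.restrict_eq] at h1 ⊢
    rw [hν.restrict_eq] at h3 ⊢
    simp only [integral_const, probReal_univ, one_smul] at h1 ⊢
    linarith
  -- The infimum may not be attained; a point within `1` of it bounds the transform by `M + 1` on
  -- `X`.
  · obtain ⟨_, ⟨y, hy, rfl⟩, hyc⟩ := exists_lt_of_csInf_lt (hY.image ψ)
      (show sInf (ψ '' Y) < c + 1 by linarith)
    have h1 := setIntegral_mono_on (hq _ hfm) (integrableOn_const (C := M + 1))
      hXo.measurableSet fun x hx => (quadTransform_le hfm.1.2 x hy).trans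
        (show ψ y - c + ‖x - y‖ ^ 2 ≤ M + 1 by linarith [hM x hx y hy])
    simp only [dualFunctional]
    rw [hμ.restrict_eq] at h1 ⊢
    rw [integral_const, probReal_univ, one_smul] at h1
    linarith

/-! ### Existence of the maximizer. -/

theorem const_smul_restrict_le {Y : Set (Space d)} {ν : Measure (Space d)} {a : ℝ≥0∞}
    (ha : ∀ᵐ y ∂(volume.restrict Y), a ≤ ν.rnDeriv volume y) :
    a • volume.restrict Y ≤ ν.restrict Y := by
  refine Measure.le_iff.2 fun s hs => ?_
  rw [Measure.smul_apply, smul_eq_mul, Measure.restrict_apply hs, Measure.restrict_apply hs,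
    ← setLIntegral_const]
  refine le_trans ?_ (Measure.setLIntegral_rnDeriv_le (μ := ν) (ν := volume) (s ∩ Y))
  exact lintegral_mono_ae (ae_restrict_of_ae_restrict_of_subset inter_subset_right ha)

/-- The ball about `y` of half the distance to `Yᶜ` lies in `Y`. Taking for `w` that radius to the
power `d` cancels the volume in `SphereSubmean.le_div_measure`, so bounds that blow up at the
boundary become a single constant. -/
theorem exists_weight (hd : 1 ≤ d) {Y : Set (Space d)} (hYo : IsOpen Y)
    (hYb : Bornology.IsBounded Y) {B : ℝ≥0∞} (hB : B ≠ ∞) :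
    ∃ (w : Space d → ℝ) (C : ℝ), Continuous w ∧ (∀ y ∈ Y, 0 < w y) ∧ 0 ≤ C ∧
      ∀ h : Space d → ℝ≥0∞, Measurable h → SphereSubmean volume Y h →
        ∫⁻ y, h y ≤ B → ∀ y ∈ Y, w y * (h y).toReal ≤ C := by
  have : Nonempty (Fin d) := ⟨⟨0, hd⟩⟩
  have hne : (Yᶜ).Nonempty := by
    rw [nonempty_compl]
    rintro rfl
    exact NormedSpace.unbounded_univ ℝ (Space d) hYb
  have hpos (y) (hy : y ∈ Y) : 0 < infDist y Yᶜ / 2 :=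
    half_pos ((hYo.isClosed_compl.notMem_iff_infDist_pos hne).1 (by simpa using hy))
  have hv : (volume (ball (0 : Space d) 1)) ≠ 0 := (measure_ball_pos _ _ one_pos).ne'
  have hv' : (volume (ball (0 : Space d) 1)) ≠ ∞ := measure_ball_lt_top.ne
  refine ⟨fun y => (infDist y Yᶜ / 2) ^ Module.finrank ℝ (Space d),
    (B / volume (ball (0 : Space d) 1)).toReal,
    ((continuous_infDist_pt _).div_const 2).pow _, fun y hy => pow_pos (hpos y hy) _,
    ENNReal.toReal_nonneg, fun h hh hs hhB y hy => ?_⟩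
  have hsub : closedBall y (infDist y Yᶜ / 2) ⊆ Y := by
    intro z hz
    by_contra hzY
    have h1 := infDist_le_dist_of_mem (x := y) (show z ∈ Yᶜ from hzY)
    rw [mem_closedBall, dist_comm] at hz
    linarith [hpos y hy]
  have h1 := hs.le_div_measure volume hh hhB (hpos y hy) hsub
  rw [Measure.addHaar_closedBall _ _ (hpos y hy).le] at h1
  set t := (infDist y Yᶜ / 2) ^ Module.finrank ℝ (Space d) with ht
  have ht0 : 0 < t := pow_pos (hpos y hy) _
  change t * _ ≤ _
  rw [← ENNReal.toReal_ofReal ht0.le, ← ENNReal.toReal_mul]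
  refine ENNReal.toReal_mono (ENNReal.div_ne_top hB hv) ?_
  refine (mul_le_mul_right h1 _).trans (le_of_eq ?_)
  rw [div_eq_mul_inv, ENNReal.mul_inv (.inr hv') (.inr hv), mul_left_comm,
    ← mul_assoc (ENNReal.ofReal t),
    ENNReal.mul_inv_cancel (ENNReal.ofReal_pos.2 ht0).ne' ENNReal.ofReal_ne_top, one_mul,
    div_eq_mul_inv]

theorem measurable_indicator_ofReal {Y : Set (Space d)} (hY : MeasurableSet Y) {f : Space d → ℝ}
    (hf : ContinuousOn f Y) : Measurable (Y.indicator fun y => ENNReal.ofReal (f y)) := by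
  classical
  have h := (ENNReal.continuous_ofReal.comp_continuousOn hf).measurable_piecewise
    (continuousOn_const (c := (0 : ℝ≥0∞)) (s := Yᶜ)) hY
  exact (piecewise_eq_indicator (s := Y) (f := ENNReal.ofReal ∘ f)) ▸ h

/-- An almost everywhere convergent sequence of nonnegative continuous subharmonic functions with
bounded integrals has a subharmonic almost everywhere limit which is everywhere at least the upper
limit of the sequence. -/
theorem exists_subharmonic_limit (hd : 1 ≤ d) {Y : Set (Space d)} (hYo : IsOpen Y)
    {f : ℕ → Space d → ℝ} (hfs : ∀ n, IsSubharmonicOn (f n) Y) (hfc : ∀ n, ContinuousOn (f n) Y)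
    (hf0 : ∀ n, ∀ y ∈ Y, 0 ≤ f n y) {B : ℝ≥0∞} (hB : B ≠ ∞)
    (hfB : ∀ n, ∫⁻ y in Y, ENNReal.ofReal (f n y) ≤ B) {φ : Space d → ℝ}
    (hlim : ∀ᵐ y ∂(volume.restrict Y), Tendsto (fun n => f n y) atTop (𝓝 (φ y))) :
    ∃ ψ : Space d → ℝ, IsSubharmonicOn ψ Y ∧ (∀ y, 0 ≤ ψ y) ∧
      (∀ y ∈ Y, limsup (fun n => ENNReal.ofReal (f n y)) atTop ≤ ENNReal.ofReal (ψ y)) ∧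
      ∀ᵐ y ∂(volume.restrict Y), Tendsto (fun n => ENNReal.ofReal (f n y)) atTop
        (𝓝 (ENNReal.ofReal (ψ y))) := by
  have : Nonempty (Fin d) := ⟨⟨0, hd⟩⟩
  have hYm := hYo.measurableSet
  set G : ℕ → Space d → ℝ≥0∞ := fun n => Y.indicator fun y => ENNReal.ofReal (f n y) with hGdef
  have hG (n) : Measurable (G n) := measurable_indicator_ofReal hYm (hfc n)
  have hGY (n) {y} (hy : y ∈ Y) : G n y = ENNReal.ofReal (f n y) := indicator_of_mem hy _
  have hs (n) : SphereSubmean volume Y (G n) := (hfs n).sphereSubmean (hf0 n)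
  have hGB (n) : ∫⁻ y, G n y ≤ B := by
    rw [hGdef, lintegral_indicator hYm]
    exact hfB n
  -- `φ` need not be measurable; this upper limit is, and it agrees with the limit almost
  -- everywhere.
  set Φ : Space d → ℝ≥0∞ := fun y => limsup (fun n => G n y) atTop with hΦdef
  have hΦ : Measurable Φ := Measurable.limsup hG
  have hGlim : ∀ᵐ y, Tendsto (fun n => G n y) atTop (𝓝 (Φ y)) := by
    filter_upwards [(ae_restrict_iff' hYm).1 hlim] with y hy
    by_cases hyY : y ∈ Y
    · have h1 : Tendsto (fun n => G n y) atTop (𝓝 (ENNReal.ofReal (φ y))) := by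
        simp only [hGY _ hyY]
        exact ENNReal.tendsto_ofReal (hy hyY)
      rwa [show Φ y = _ from h1.limsup_eq]
    · have h1 (n) : G n y = 0 := indicator_of_notMem hyY _
      simp [hΦdef, h1]
  have hΦfin : ∫⁻ y, Φ y ≠ ∞ := by
    refine (lt_of_le_of_lt ?_ hB.lt_top).ne
    calc ∫⁻ y, Φ y = ∫⁻ y, liminf (fun n => G n y) atTop :=
          lintegral_congr_ae (hGlim.mono fun y hy => hy.liminf_eq.symm)
      _ ≤ liminf (fun n => ∫⁻ y, G n y) atTop := lintegral_liminf_le hG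
      _ ≤ B := liminf_le_of_le (by isBoundedDefault) fun b hb => by
          obtain ⟨n, hn⟩ := hb.exists
          exact hn.trans (hGB n)
  have hbd (K : Set (Space d)) (hK : IsCompact K) (hKY : K ⊆ Y) :=
    exists_bound_limitMean volume hYo hG hs hB hGB hGlim hΦ hΦfin hK hKY
  have hfin {y} (hy : y ∈ Y) : limitMean volume Φ y ≠ ∞ := by
    obtain ⟨C, hC, hle⟩ := hbd {y} isCompact_singleton (singleton_subset_iff.2 hy)
    exact ((hle y rfl).trans_lt hC.lt_top).ne
  refine ⟨fun y => (limitMean volume Φ y).toReal, isSubharmonicOn_toReal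
    (upperSemicontinuousOn_limitMean volume hYo hG hs hB hGB hGlim hΦ hΦfin)
    (sphereSubmean_limitMean volume hYo hG hs hB hGB hGlim hΦ hΦfin) hbd,
    fun y => ENNReal.toReal_nonneg, fun y hy => ?_, ?_⟩
  · rw [ENNReal.ofReal_toReal (hfin hy)]
    simpa only [hGY _ hy] using limsup_le_limitMean volume hYo hG hs hB hGB hGlim hy
  · filter_upwards [ae_restrict_of_ae hGlim, ae_restrict_mem hYm,
      ae_restrict_of_ae (limitMean_ae_eq volume hΦ hΦfin)] with y h1 h2 h3
    rw [ENNReal.ofReal_toReal (hfin h2), h3]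
    simpa only [hGY _ h2] using h1

/-- The upper limit of the integrals of the quadratic transforms. -/
theorem limsup_lintegral_quadTransform_le {X Y : Set (Space d)} (hXo : IsOpen X)
    (hYne : Y.Nonempty) {μ : Measure (Space d)} [IsFiniteMeasure μ] {M : ℝ}
    (hM : ∀ x ∈ X, ∀ y ∈ Y, ‖x - y‖ ^ 2 ≤ M) {f : ℕ → Space d → ℝ}
    (hf0 : ∀ n, ∀ y ∈ Y, 0 ≤ f n y) {ψ : Space d → ℝ} (hψ0 : ∀ y, 0 ≤ ψ y)
    (hbd : ∃ y ∈ Y, ∃ C, ∀ n, f n y ≤ C)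
    (hle : ∀ y ∈ Y, limsup (fun n => ENNReal.ofReal (f n y)) atTop ≤ ENNReal.ofReal (ψ y)) :
    limsup (fun n => ∫⁻ x in X, ENNReal.ofReal (quadTransform Y (f n) x) ∂μ) atTop
      ≤ ∫⁻ x in X, ENNReal.ofReal (quadTransform Y ψ x) ∂μ := by
  have hfb (n) : BddBelow (f n '' Y) := ⟨0, by rintro _ ⟨y, hy, rfl⟩; exact hf0 n y hy⟩
  obtain ⟨y₀, hy₀, C, hC⟩ := hbd
  refine (limsup_lintegral_le (fun _ => ENNReal.ofReal (C + M))
    (fun n => (measurable_quadTransform (hfb n)).ennreal_ofReal)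
    (fun n => (ae_restrict_iff' hXo.measurableSet).2 (.of_forall fun x hx =>
      ENNReal.ofReal_le_ofReal ?_)) ?_).trans (lintegral_mono fun x => ?_)
  · exact (quadTransform_le (hfb n) x hy₀).trans (add_le_add (hC n) (hM x hx y₀ hy₀))
  · rw [lintegral_const]
    exact ENNReal.mul_ne_top ENNReal.ofReal_ne_top (measure_ne_top _ _)
  -- The transform is an infimum over all points, so an almost everywhere comparison of `f n` with
  -- `ψ` would not do: `hle` is used at each `y`, and then the infimum is taken.
  · have h1 : ∀ y ∈ Y, limsup (fun n => ENNReal.ofReal (quadTransform Y (f n) x)) atTop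
        ≤ ENNReal.ofReal (ψ y + ‖x - y‖ ^ 2) := by
      intro y hy
      have h2 (n) : ENNReal.ofReal (quadTransform Y (f n) x)
          ≤ ENNReal.ofReal (f n y) + ENNReal.ofReal (‖x - y‖ ^ 2) := by
        rw [← ENNReal.ofReal_add (hf0 n y hy) (sq_nonneg _)]
        exact ENNReal.ofReal_le_ofReal (quadTransform_le (hfb n) x hy)
      refine (limsup_le_limsup (.of_forall h2)).trans ?_
      rw [limsup_add_const _ _ _ (by isBoundedDefault) (by isBoundedDefault),
        ENNReal.ofReal_add (hψ0 y) (sq_nonneg _)]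
      gcongr
      exact hle y hy
    set t := limsup (fun n => ENNReal.ofReal (quadTransform Y (f n) x)) atTop
    have ht : t ≠ ∞ := ((h1 y₀ hy₀).trans_lt ENNReal.ofReal_lt_top).ne
    rw [← ENNReal.ofReal_toReal ht]
    refine ENNReal.ofReal_le_ofReal (le_quadTransform hYne fun y hy => ?_)
    exact ENNReal.toReal_le_of_le_ofReal (add_nonneg (hψ0 y) (sq_nonneg _)) (h1 y hy)

theorem exists_dualValue_le (hd : 1 ≤ d) {X Y : Set (Space d)} (hXo : IsOpen X) (hYo : IsOpen Y)
    (hXb : Bornology.IsBounded X) (hYb : Bornology.IsBounded Y) {μ ν : Measure (Space d)}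
    (hμ : IsProbOn X μ) (hν : IsProbOn Y ν) (hac : ν ≪ volume)
    (hdens : ∃ a : ℝ≥0, 0 < a ∧ ∀ᵐ y ∂(volume.restrict Y), (a : ℝ≥0∞) ≤ ν.rnDeriv volume y) :
    ∃ ψ₀ ∈ SubharmonicBddBelow Y, IntegrableOn ψ₀ Y ν ∧ IntegrableOn (quadTransform Y ψ₀) X μ ∧
      dualValue X Y μ ν ≤ (dualFunctional X Y μ ν ψ₀ : EReal) := by
  have := hμ.1
  have := hν.1
  have hYm := hYo.measurableSet
  have hYne := hν.nonempty
  obtain ⟨a, ha, hdens⟩ := hdens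
  obtain ⟨M, -, hM⟩ := exists_bound_normSq_sub hXb hYb
  obtain ⟨D, hD, -, hDex⟩ := exists_dualValue_eq hd hXo hYo hXb hYb hμ hν
  -- `M + 2 - D` is the bound `M + 1 - dualFunctional` of the normalization at the worst value `D -
  -- 1`; it does not depend on `n` and survives midpoints.
  set A : ℕ → Set (Space d → ℝ) := fun n => {f | f ∈ DualClass Y ∧ (∀ y ∈ Y, 0 ≤ f y) ∧
    ∫ y in Y, f y ∂ν ≤ M + 2 - D ∧ D - 1 / ((n : ℝ) + 1) ≤ dualFunctional X Y μ ν f} with hA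
  have hanti : Antitone A := fun m n hmn f ⟨h1, h2, h3, h4⟩ =>
    ⟨h1, h2, h3, by linarith [Nat.one_div_le_one_div (α := ℝ) hmn]⟩
  have hne (n) : (A n).Nonempty := by
    have hn : (0 : ℝ) < 1 / ((n : ℝ) + 1) := Nat.one_div_pos_of_nat
    have hn' : 1 / ((n : ℝ) + 1) ≤ 1 := by
      have := Nat.one_div_le_one_div (α := ℝ) (Nat.zero_le n)
      simpa using this
    obtain ⟨ψ, hψ, hψD⟩ := hDex _ hn
    obtain ⟨f, hf, hf0, hf1, hf2⟩ :=
      exists_nonneg_dualFunctional_ge hd hXo hYo hXb hYb hμ hν hM hψ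
    exact ⟨f, hf, hf0, by linarith, by linarith⟩
  have hi {n} {f} (hf : f ∈ A n) : IntegrableOn f Y ν :=
    integrableOn_of_boundedContinuousOn hYm hf.1.2
  have hmid (n) : ∀ f ∈ A n, ∀ g ∈ A n, (fun y => 1 / 2 * f y + 1 / 2 * g y) ∈ A n := by
    intro f hf g hg
    have h2 : (0 : ℝ) ≤ 1 / 2 := by norm_num
    refine ⟨dualClass_add_mul hf.1 hg.1 h2 h2, fun y hy => ?_, ?_, ?_⟩
    · linarith [hf.2.1 y hy, hg.2.1 y hy]
    · rw [integral_add ((hi hf).const_mul _) ((hi hg).const_mul _), integral_const_mul,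
        integral_const_mul]
      linarith [hf.2.2.1, hg.2.2.1]
    · have := add_mul_dualFunctional_le hXo hYo hXb hYb hμ hν hf.1 hg.1 h2 h2 (by norm_num)
      linarith [hf.2.2.2, hg.2.2.2]
  -- the Lebesgue integrals are bounded
  set B : ℝ≥0∞ := (a : ℝ≥0∞)⁻¹ * ENNReal.ofReal (M + 2 - D) with hBdef
  have ha0 : (a : ℝ≥0∞) ≠ 0 := ENNReal.coe_ne_zero.2 ha.ne'
  have hB : B ≠ ∞ := ENNReal.mul_ne_top (ENNReal.inv_ne_top.2 ha0) ENNReal.ofReal_ne_top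
  have hnn {n} {f} (hf : f ∈ A n) : 0 ≤ᵐ[ν.restrict Y] f :=
    (ae_restrict_iff' hYm).2 (.of_forall hf.2.1)
  have hAB {n} {f} (hf : f ∈ A n) : ∫⁻ y in Y, ENNReal.ofReal (f y) ≤ B := by
    have h1 := lintegral_mono' (const_smul_restrict_le hdens)
      (le_refl fun y => ENNReal.ofReal (f y))
    rw [lintegral_smul_measure, ← ofReal_integral_eq_lintegral_ofReal (hi hf) (hnn hf),
      smul_eq_mul] at h1
    rw [hBdef, ← ENNReal.div_eq_inv_mul, ENNReal.le_div_iff_mul_le (.inl ha0)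
      (.inl ENNReal.coe_ne_top), mul_comm]
    exact h1.trans (ENNReal.ofReal_le_ofReal hf.2.2.1)
  have hfc {n} {f} (hf : f ∈ A n) : ContinuousOn f Y := hf.1.2.1
  obtain ⟨w, C, hwc, hw0, hC0, hwC⟩ := exists_weight hd hYo hYb hB
  have hvol : IsFiniteMeasure ((volume : Measure (Space d)).restrict Y) :=
    ⟨by rw [Measure.restrict_apply_univ]; exact hYb.measure_lt_top⟩
  -- The extraction needs uniformly bounded functions, so it is applied to `w * f`, and `w` is
  -- divided out afterwards.
  obtain ⟨F, φ, hF, hφ⟩ := exists_seq_ae_tendsto (m := volume.restrict Y)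
    (A := fun n => (fun f y => w y * f y) '' A n) (fun m n hmn => image_mono (hanti hmn))
    (fun n => (hne n).image _)
    (by
      rintro n _ ⟨f, hf, rfl⟩ _ ⟨g, hg, rfl⟩
      exact ⟨_, hmid n f hf g hg, by ext y; simp only; ring⟩)
    (by
      rintro _ ⟨f, hf, rfl⟩
      exact (hwc.continuousOn.mul (hfc hf)).aestronglyMeasurable hYm)
    hC0
    (by
      rintro _ ⟨f, hf, rfl⟩
      refine (ae_restrict_iff' hYm).2 (.of_forall fun y hy => ?_)
      have h1 := hwC _ (measurable_indicator_ofReal hYm (hfc hf))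
        (hf.1.1.1.sphereSubmean hf.2.1) (by rw [lintegral_indicator hYm]; exact hAB hf) y hy
      rw [indicator_of_mem hy, ENNReal.toReal_ofReal (hf.2.1 y hy)] at h1
      rwa [Real.norm_of_nonneg (mul_nonneg (hw0 y hy).le (hf.2.1 y hy))])
  choose f hfA hfF using hF
  have hlim : ∀ᵐ y ∂(volume.restrict Y), Tendsto (fun n => f n y) atTop (𝓝 (φ y / w y)) := by
    filter_upwards [hφ, ae_restrict_mem hYm] with y h1 h2
    refine (h1.div_const (w y)).congr fun n => ?_
    rw [← hfF n, mul_div_cancel_left₀ _ (hw0 y h2).ne']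
  obtain ⟨ψ, hψs, hψ0, hψle, hψlim⟩ := exists_subharmonic_limit hd hYo
    (fun n => (hfA n).1.1.1) (fun n => hfc (hfA n)) (fun n => (hfA n).2.1) hB
    (fun n => hAB (hfA n)) hlim
  have hψb : BddBelow (ψ '' Y) := ⟨0, by rintro _ ⟨y, -, rfl⟩; exact hψ0 y⟩
  have hQi := integrableOn_quadTransform hXo.measurableSet hXb hYb hYne (μ := μ) hψb
  -- Fatou's lemma for `ψ`
  have hψν : ∀ᵐ y ∂(ν.restrict Y), Tendsto (fun n => ENNReal.ofReal (f n y)) atTop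
      (𝓝 (ENNReal.ofReal (ψ y))) := (hac.restrict Y).ae_le hψlim
  have hfm (n) : AEMeasurable (fun y => ENNReal.ofReal (f n y)) (ν.restrict Y) :=
    (hi (hfA n)).aestronglyMeasurable.aemeasurable.ennreal_ofReal
  have hfatou : ∫⁻ y in Y, ENNReal.ofReal (ψ y) ∂ν
      ≤ liminf (fun n => ∫⁻ y in Y, ENNReal.ofReal (f n y) ∂ν) atTop := by
    refine le_trans (le_of_eq ?_) (lintegral_liminf_le' hfm)
    exact lintegral_congr_ae (hψν.mono fun y hy => hy.liminf_eq.symm)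
  have hfI (n) : ∫⁻ y in Y, ENNReal.ofReal (f n y) ∂ν = ENNReal.ofReal (∫ y in Y, f n y ∂ν) :=
    (ofReal_integral_eq_lintegral_ofReal (hi (hfA n)) (hnn (hfA n))).symm
  have hψm : AEMeasurable ψ (ν.restrict Y) := by
    have h1 := aemeasurable_of_tendsto_metrizable_ae atTop hfm hψν
    refine h1.ennreal_toReal.congr (.of_forall fun y => ?_)
    exact ENNReal.toReal_ofReal (hψ0 y)
  have hψi : IntegrableOn ψ Y ν := by
    refine ⟨hψm.aestronglyMeasurable, ?_⟩
    rw [hasFiniteIntegral_iff_ofReal (.of_forall hψ0)]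
    refine hfatou.trans_lt (lt_of_le_of_lt (liminf_le_of_le (by isBoundedDefault)
      (a := ENNReal.ofReal (M + 2 - D)) fun b hb => ?_) ENNReal.ofReal_lt_top)
    obtain ⟨n, hn⟩ := hb.exists
    exact hn.trans ((hfI n).trans_le (ENNReal.ofReal_le_ofReal (hfA n).2.2.1))
  refine ⟨ψ, ⟨hψs, hψb⟩, hψi, hQi, ?_⟩
  -- the reverse Fatou lemma for the quadratic transforms
  have hbd : ∃ y ∈ Y, ∃ C, ∀ n, f n y ≤ C := by
    obtain ⟨y, hy⟩ := hYne
    refine ⟨y, hy, C / w y, fun n => ?_⟩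
    have h1 := hwC _ (measurable_indicator_ofReal hYm (hfc (hfA n)))
      ((hfA n).1.1.1.sphereSubmean (hfA n).2.1)
      (by rw [lintegral_indicator hYm]; exact hAB (hfA n)) y hy
    rw [indicator_of_mem hy, ENNReal.toReal_ofReal ((hfA n).2.1 y hy), mul_comm] at h1
    rwa [le_div_iff₀ (hw0 y hy)]
  have hlimsup := limsup_lintegral_quadTransform_le hXo hYne (μ := μ) hM (fun n => (hfA n).2.1) hψ0
    hbd hψle
  have hQ0 {g : Space d → ℝ} (hg : ∀ y ∈ Y, 0 ≤ g y) (x) : 0 ≤ quadTransform Y g x :=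
    le_quadTransform_of_le hYne hg
  have hQI {g : Space d → ℝ} (hg : ∀ y ∈ Y, 0 ≤ g y) :
      ∫⁻ x in X, ENNReal.ofReal (quadTransform Y g x) ∂μ
        = ENNReal.ofReal (∫ x in X, quadTransform Y g x ∂μ) :=
    (ofReal_integral_eq_lintegral_ofReal (integrableOn_quadTransform hXo.measurableSet hXb hYb hYne
      ⟨0, by rintro _ ⟨y, hy, rfl⟩; exact hg y hy⟩) (.of_forall (hQ0 hg))).symm
  rw [hQI fun y _ => hψ0 y] at hlimsup
  simp only [hQI (hfA _).2.1] at hlimsup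
  rw [← ofReal_integral_eq_lintegral_ofReal hψi (.of_forall hψ0)] at hfatou
  simp only [hfI] at hfatou
  rw [hD, EReal.coe_le_coe_iff]
  refine le_of_forall_pos_le_add fun ε hε => ?_
  have hε4 : 0 < ε / 4 := by positivity
  set q := ∫ x in X, quadTransform Y ψ x ∂μ with hq
  set i := ∫ y in Y, ψ y ∂ν with hidef
  have hq0 : 0 ≤ q := integral_nonneg (hQ0 fun y _ => hψ0 y)
  have e1 : ∀ᶠ n in atTop, ∫ x in X, quadTransform Y (f n) x ∂μ < q + ε / 4 := by
    have h1 : ENNReal.ofReal q < ENNReal.ofReal (q + ε / 4) :=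
      (ENNReal.ofReal_lt_ofReal_iff (by positivity)).2 (by linarith)
    filter_upwards [eventually_lt_of_limsup_lt (hlimsup.trans_lt h1)] with n hn
    exact (ENNReal.ofReal_lt_ofReal_iff (by positivity)).1 hn
  have e2 : ∀ᶠ n in atTop, i - ε / 4 < ∫ y in Y, f n y ∂ν := by
    -- `ENNReal.ofReal` truncates at `0`, so a negative threshold is treated apart.
    by_cases hi0 : i - ε / 4 < 0
    · exact .of_forall fun n => hi0.trans_le (integral_nonneg_of_ae (hnn (hfA n)))
    · have h1 : ENNReal.ofReal (i - ε / 4) < ENNReal.ofReal i :=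
        (ENNReal.ofReal_lt_ofReal_iff (by linarith)).2 (by linarith)
      filter_upwards [eventually_lt_of_lt_liminf (h1.trans_le hfatou)] with n hn
      exact (ENNReal.ofReal_lt_ofReal_iff_of_nonneg (not_lt.1 hi0)).1 hn
  have e3 : ∀ᶠ n : ℕ in atTop, 1 / ((n : ℝ) + 1) < ε / 4 :=
    tendsto_one_div_add_atTop_nhds_zero_nat.eventually_lt_const hε4
  obtain ⟨n, h1, h2, h3⟩ := (e1.and (e2.and e3)).exists
  have h4 := (hfA n).2.2.2
  simp only [dualFunctional] at h4 ⊢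
  linarith

/-! ### Convex functions as subharmonic test functions. -/

section Convex

theorem measurePreserving_neg_toSphere {E : Type*} [NormedAddCommGroup E] [NormedSpace ℝ E]
    [FiniteDimensional ℝ E] [MeasurableSpace E] [BorelSpace E] (μ : Measure E)
    [μ.IsAddHaarMeasure] :
    MeasurePreserving (fun θ : sphere (0 : E) 1 => -θ) μ.toSphere μ.toSphere := by
  have hm : Measurable fun θ : sphere (0 : E) 1 => -θ := continuous_neg.measurable
  refine ⟨hm, Measure.ext fun s hs => ?_⟩
  rw [Measure.map_apply hm hs, Measure.toSphere_apply' _ (hm hs), Measure.toSphere_apply' _ hs]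
  have h1 : ((↑) '' ((fun θ : sphere (0 : E) 1 => -θ) ⁻¹' s) : Set E) = -((↑) '' s) := by
    ext x
    simp only [mem_image, mem_preimage, Set.mem_neg]
    constructor
    · rintro ⟨θ, hθ, rfl⟩
      exact ⟨-θ, hθ, rfl⟩
    · rintro ⟨θ, hθ, h⟩
      exact ⟨-θ, by simpa using hθ, by simp [h]⟩
  rw [h1, Set.smul_neg, Measure.measure_neg]


/-- The centre is the midpoint of each pair of antipodal points; integrate midpoint convexity over
the sphere, whose measure the antipodal map preserves. -/
theorem isSubharmonicOn_of_convexOn (hd : 1 ≤ d) {f : Space d → ℝ} (hf : Continuous f)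
    (hc : ConvexOn ℝ univ f) (U : Set (Space d)) : IsSubharmonicOn f U := by
  have : Nonempty (Fin d) := ⟨⟨0, hd⟩⟩
  have : NeZero (volume : Measure (Space d)).toSphere := ⟨Measure.toSphere_ne_zero _⟩
  refine ⟨hf.continuousOn.upperSemicontinuousOn, fun x r hr hx => ?_⟩
  have hcont : Continuous fun θ : sphere (0 : Space d) 1 => f (x + r • (θ : Space d)) := by
    fun_prop
  have hint : Integrable (fun θ : sphere (0 : Space d) 1 => f (x + r • (θ : Space d)))
      (volume : Measure (Space d)).toSphere :=
    hcont.integrable_of_hasCompactSupport (HasCompactSupport.of_compactSpace _)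
  refine ⟨hint, ?_⟩
  have hneg := measurePreserving_neg_toSphere (volume : Measure (Space d))
  have hemb : MeasurableEmbedding fun θ : sphere (0 : Space d) 1 => -θ :=
    (Homeomorph.neg _).measurableEmbedding
  have hint' := (hneg.integrable_comp_emb hemb).2 hint
  have hI := hneg.integral_comp hemb fun θ : sphere (0 : Space d) 1 => f (x + r • (θ : Space d))
  have h1 := integral_mono (integrable_const (f x))
    ((hint.const_mul (1 / 2)).add (hint'.const_mul (1 / 2))) fun θ => by
      have h2 := hc.2 (mem_univ (x + r • (θ : Space d)))
        (mem_univ (x + r • ((-θ : sphere _ _) : Space d)))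
        (show (0 : ℝ) ≤ 1 / 2 by norm_num) (show (0 : ℝ) ≤ 1 / 2 by norm_num) (by norm_num)
      have h3 : (1 / 2 : ℝ) • (x + r • (θ : Space d))
          + (1 / 2 : ℝ) • (x + r • ((-θ : sphere _ _) : Space d)) = x := by
        simp only [coe_neg_sphere]
        module
      rw [h3] at h2
      exact h2
  have h4 := integral_add (hint.const_mul (1 / 2)) (hint'.const_mul (1 / 2))
  simp only [Pi.add_apply, Function.comp_def] at h1 h4 hI
  rw [h4, integral_const_mul, integral_const_mul, hI, integral_const, smul_eq_mul] at h1
  rw [average_eq, smul_eq_mul, ← div_eq_inv_mul, le_div_iff₀]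
  · linarith
  · exact ENNReal.toReal_pos (Measure.measure_univ_ne_zero.2 (NeZero.ne _)) (measure_ne_top _ _)

/-- A continuous convex function with values in `[0, 1)` exactly on a given open convex set. -/
theorem exists_convex_defining_function {Y : Set (Space d)} (hYo : IsOpen Y) (hYc : Convex ℝ Y)
    (hY : Y.Nonempty) : ∃ v : Space d → ℝ, Continuous v ∧ ConvexOn ℝ univ v ∧ (∀ y, 0 ≤ v y) ∧
      ∀ y, v y < 1 ↔ y ∈ Y := by
  obtain ⟨y₀, hy₀⟩ := hY
  -- The function is the Minkowski gauge of `Y`, translated so that the origin is an interior point.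
  set s : Set (Space d) := (fun z => y₀ + z) ⁻¹' Y with hs
  have hso : IsOpen s := hYo.preimage (by fun_prop)
  have hsc : Convex ℝ s := hYc.translate_preimage_right y₀
  have hs0 : (0 : Space d) ∈ s := by simpa [hs] using hy₀
  have hsn := hso.mem_nhds hs0
  have hcv : ConvexOn ℝ univ (gauge s) := by
    refine ⟨convex_univ, fun x _ y _ a b ha hb _ => ?_⟩
    refine (gauge_add_le hsc (absorbent_nhds_zero hsn) _ _).trans ?_
    rw [gauge_smul_of_nonneg ha, gauge_smul_of_nonneg hb]
  refine ⟨fun y => gauge s (y - y₀), (continuous_gauge hsc hsn).comp (by fun_prop), ?_,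
    fun y => gauge_nonneg _, fun y => ?_⟩
  · have := hcv.translate_left (-y₀)
    simpa [Function.comp_def, sub_eq_add_neg] using this
  · have := Set.ext_iff.1 (setOfPred_gauge_lt_one_eq_self_of_isOpen hsc hs0 hso) (y - y₀)
    simpa [hs] using this

end Convex

/-! ### Hahn-Banach and Riesz representation. -/

section Functional

/-- Extend `c • x₀ ↦ c * p x₀` from the line through `x₀`; for negative `c` it lies below `p`
because `0 = p 0 ≤ p x + p (-x)`. -/
theorem exists_linearMap_le_sublinear_eq {V : Type*} [AddCommGroup V] [Module ℝ V] {p : V → ℝ}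
    (hom : ∀ c : ℝ, 0 < c → ∀ x, p (c • x) = c * p x) (add : ∀ x y, p (x + y) ≤ p x + p y)
    (x₀ : V) : ∃ g : V →ₗ[ℝ] ℝ, g x₀ = p x₀ ∧ ∀ x, g x ≤ p x := by
  have p0 : p 0 = 0 := by
    have := hom 2 two_pos 0
    rw [smul_zero] at this
    linarith
  have hneg (x : V) : -p x ≤ p (-x) := by
    have := add x (-x)
    rw [add_neg_cancel, p0] at this
    linarith
  have hle (c : ℝ) : c * p x₀ ≤ p (c • x₀) := by
    rcases lt_trichotomy c 0 with hc | rfl | hc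
    · have h1 := hneg ((-c) • x₀)
      rw [hom _ (neg_pos.2 hc), ← neg_smul, neg_neg] at h1
      linarith
    · simp [p0]
    · exact (hom c hc x₀).ge
  have H : ∀ c : ℝ, c • x₀ = 0 → c • p x₀ = 0 := by
    intro c hc
    by_contra h0
    have hx : x₀ = 0 := (smul_eq_zero.1 hc).resolve_left fun h => h0 (by simp [h])
    exact h0 (by simp [hx, p0])
  obtain ⟨g, hg, hgp⟩ := exists_extension_of_le_sublinear
    (LinearPMap.mkSpanSingleton' x₀ (p x₀) H) p hom add (by
      rintro ⟨x, hx⟩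
      obtain ⟨c, rfl⟩ := Submodule.mem_span_singleton.1 hx
      rw [LinearPMap.mkSpanSingleton'_apply]
      exact hle c)
  refine ⟨g, ?_, hgp⟩
  have hx : x₀ ∈ Submodule.span ℝ {x₀} := Submodule.mem_span_singleton_self x₀
  exact (hg ⟨x₀, hx⟩).trans (LinearPMap.mkSpanSingleton'_apply_self ..)

open scoped CompactlySupported in
theorem exists_measure_of_nonneg_functional {Z : Type*} [TopologicalSpace Z] [T2Space Z]
    [MeasurableSpace Z] [BorelSpace Z] {K : Set Z} (hK : IsCompact K) (Λ : C(K, ℝ) →ₗ[ℝ] ℝ)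
    (hΛ : ∀ h, 0 ≤ h → 0 ≤ Λ h) :
    ∃ π : Measure Z, IsFiniteMeasure π ∧ ∀ F : C(Z, ℝ),
      Integrable F π ∧ ∫ z, F z ∂π = Λ (F.restrict K) := by
  have : CompactSpace K := isCompact_iff_compactSpace.1 hK
  let Λ₀ : C_c(K, ℝ) →ₗ[ℝ] ℝ :=
    { toFun := fun f => Λ f.toContinuousMap
      map_add' := fun f g => Λ.map_add f.toContinuousMap g.toContinuousMap
      map_smul' := fun c f => Λ.map_smul c f.toContinuousMap }
  let Λ' : C_c(K, ℝ) →ₚ[ℝ] ℝ := PositiveLinearMap.mk₀ Λ₀ fun f hf => hΛ _ hf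
  have hfin : IsFiniteMeasure (RealRMK.rieszMeasure Λ') := inferInstance
  have hemb : MeasurableEmbedding ((↑) : K → Z) := MeasurableEmbedding.subtype_coe hK.measurableSet
  refine ⟨(RealRMK.rieszMeasure Λ').map (↑), inferInstance, fun F => ⟨?_, ?_⟩⟩
  · rw [hemb.integrable_map_iff]
    exact (F.continuous.comp continuous_subtype_val).integrable_of_hasCompactSupport
      (HasCompactSupport.of_compactSpace _)
  · rw [hemb.integral_map]
    exact RealRMK.integral_rieszMeasure Λ'
      (CompactlySupportedContinuousMap.continuousMapEquiv (F.restrict K))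

end Functional

/-! ### Strong duality. -/

theorem le_integral_add_integral {X Y : Set (Space d)} (hXo : IsOpen X) (hYo : IsOpen Y)
    {μ ν : Measure (Space d)} (hμ : IsProbOn X μ) (hν : IsProbOn Y ν) {f ψ : Space d → ℝ}
    (hf : IntegrableOn f X μ) (hψ : IntegrableOn ψ Y ν) {c : ℝ}
    (h : ∀ x ∈ X, ∀ y ∈ Y, c ≤ f x + ψ y) : c ≤ ∫ x in X, f x ∂μ + ∫ y in Y, ψ y ∂ν := by
  have := hμ.1
  have := hν.1
  have h1 : ∀ x ∈ X, c - ∫ y in Y, ψ y ∂ν ≤ f x := by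
    intro x hx
    have h2 := setIntegral_mono_on (integrableOn_const (C := c - f x)) hψ hYo.measurableSet
      fun y hy => by linarith [h x hx y hy]
    rw [hν.restrict_eq] at h2 ⊢
    rw [integral_const, probReal_univ, one_smul] at h2
    linarith
  have h3 := setIntegral_mono_on integrableOn_const hf hXo.measurableSet h1
  rw [hμ.restrict_eq] at h3 ⊢
  rw [integral_const, probReal_univ, one_smul] at h3
  linarith

/-- The values `∫ f dμ + ∫ ψ dν` over all pairs with `h ≤ f ⊕ ψ` on `X × Y`, where `ψ` belongs to
the dual class. -/
def majorantValues (X Y : Set (Space d)) (μ ν : Measure (Space d)) (h : Space d × Space d → ℝ) :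
    Set ℝ :=
  {t | ∃ f ψ : Space d → ℝ, IntegrableOn f X μ ∧ ψ ∈ DualClass Y ∧
    (∀ x ∈ X, ∀ y ∈ Y, h (x, y) ≤ f x + ψ y) ∧ t = ∫ x in X, f x ∂μ + ∫ y in Y, ψ y ∂ν}

theorem add_mem_majorantValues {X Y : Set (Space d)} (hYo : IsOpen Y) {μ ν : Measure (Space d)}
    [IsFiniteMeasure ν] {h k : Space d × Space d → ℝ} {s t : ℝ}
    (hs : s ∈ majorantValues X Y μ ν h) (ht : t ∈ majorantValues X Y μ ν k) :
    s + t ∈ majorantValues X Y μ ν (fun z => h z + k z) := by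
  obtain ⟨f, ψ, hf, hψ, hle, rfl⟩ := hs
  obtain ⟨g, φ, hg, hφ, hle', rfl⟩ := ht
  refine ⟨fun x => f x + g x, fun y => 1 * ψ y + 1 * φ y, hf.add hg,
    dualClass_add_mul hψ hφ zero_le_one zero_le_one, fun x hx y hy => ?_, ?_⟩
  · linarith [hle x hx y hy, hle' x hx y hy]
  · simp only [one_mul]
    rw [integral_add hf hg, integral_add
      (integrableOn_of_boundedContinuousOn hYo.measurableSet hψ.2)
      (integrableOn_of_boundedContinuousOn hYo.measurableSet hφ.2)]
    ring

theorem mul_mem_majorantValues {X Y : Set (Space d)} {μ ν : Measure (Space d)}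
    {h : Space d × Space d → ℝ} {t : ℝ} (ht : t ∈ majorantValues X Y μ ν h) {c : ℝ} (hc : 0 ≤ c) :
    c * t ∈ majorantValues X Y μ ν (fun z => c * h z) := by
  obtain ⟨f, ψ, hf, hψ, hle, rfl⟩ := ht
  refine ⟨fun x => c * f x, fun y => c * ψ y + 0 * ψ y, hf.const_mul c,
    dualClass_add_mul hψ hψ hc le_rfl, fun x hx y hy => ?_, ?_⟩
  · have := mul_le_mul_of_nonneg_left (hle x hx y hy) hc
    simp only
    linarith
  · simp only [zero_mul, add_zero]
    rw [integral_const_mul, integral_const_mul]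
    ring

/-- The infimum `p h` of `majorantValues` is finite and sublinear. A linear functional below `p`
that touches it at minus the cost is positive, since `p ≤ 0` on nonpositive functions, hence is a
measure. In a majorant of minus the cost, `f ≥ -Q₂(ψ)` on `X`, so `p` is at least `-D` there and the
cost integral is at most `D`. -/
theorem exists_dual_measure (hd : 1 ≤ d) {X Y : Set (Space d)} (hXo : IsOpen X) (hYo : IsOpen Y)
    (hXb : Bornology.IsBounded X) (hYb : Bornology.IsBounded Y) {μ ν : Measure (Space d)}
    (hμ : IsProbOn X μ) (hν : IsProbOn Y ν) {D : ℝ}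
    (hD : ∀ ψ ∈ DualClass Y, dualFunctional X Y μ ν ψ ≤ D) :
    ∃ π : Measure (Space d × Space d), IsFiniteMeasure π ∧
      (∀ F : Space d × Space d → ℝ, Continuous F → Integrable F π ∧
        ∀ t ∈ majorantValues X Y μ ν F, ∫ z, F z ∂π ≤ t) ∧
      ∫ z, ‖z.1 - z.2‖ ^ 2 ∂π ≤ D := by
  have := hμ.1
  have := hν.1
  set K : Set (Space d × Space d) := closure X ×ˢ closure Y with hKdef
  have hK : IsCompact K := hXb.isCompact_closure.prod hYb.isCompact_closure
  have hKc : CompactSpace K := isCompact_iff_compactSpace.1 hK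
  classical
  -- continuous functions on `K`, extended by zero
  let e : C(K, ℝ) → Space d × Space d → ℝ := fun h z => if hz : z ∈ K then h ⟨z, hz⟩ else 0
  have hmemK {x y} (hx : x ∈ X) (hy : y ∈ Y) : (x, y) ∈ K :=
    ⟨subset_closure hx, subset_closure hy⟩
  have he (h : C(K, ℝ)) {z} (hz : z ∈ K) : e h z = h ⟨z, hz⟩ := dif_pos hz
  let T : C(K, ℝ) → Set ℝ := fun h => majorantValues X Y μ ν (e h)
  have hTcongr {h : C(K, ℝ)} {F : Space d × Space d → ℝ} {t : ℝ}
      (ht : t ∈ majorantValues X Y μ ν F) (hF : ∀ z (hz : z ∈ K), h ⟨z, hz⟩ = F z) : t ∈ T h := by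
    obtain ⟨f, ψ, hf, hψ, hle, rfl⟩ := ht
    refine ⟨f, ψ, hf, hψ, fun x hx y hy => ?_, rfl⟩
    rw [he h (hmemK hx hy), hF]
    exact hle x hx y hy
  have hTb (h : C(K, ℝ)) : ∀ t ∈ T h, -‖h‖ ≤ t := by
    rintro _ ⟨f, ψ, hf, hψ, hle, rfl⟩
    refine le_integral_add_integral hXo hYo hμ hν hf
      (integrableOn_of_boundedContinuousOn hYo.measurableSet hψ.2) fun x hx y hy => ?_
    refine le_trans ?_ (hle x hx y hy)
    rw [he h (hmemK hx hy)]
    exact (abs_le.1 (h.norm_coe_le_norm _)).1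
  have hTbdd (h) : BddBelow (T h) := ⟨_, hTb h⟩
  have hTne (h : C(K, ℝ)) : (T h).Nonempty := by
    refine ⟨_, fun _ => ‖h‖, fun _ => 0, integrableOn_const, const_mem_dualClass hd Y 0,
      fun x hx y hy => ?_, rfl⟩
    rw [he h (hmemK hx hy), add_zero]
    exact (abs_le.1 (h.norm_coe_le_norm _)).2
  let p : C(K, ℝ) → ℝ := fun h => sInf (T h)
  have hp_le {h : C(K, ℝ)} {t} (ht : t ∈ T h) : p h ≤ t := csInf_le (hTbdd h) ht
  have hp_smul_le (c : ℝ) (hc : 0 < c) (h : C(K, ℝ)) : p (c • h) ≤ c * p h := by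
    rw [← div_le_iff₀' hc]
    refine le_csInf (hTne h) fun t ht => ?_
    rw [div_le_iff₀' hc]
    exact hp_le (hTcongr (mul_mem_majorantValues ht hc.le) fun z hz => by
      rw [he h hz]; rfl)
  have hp_smul (c : ℝ) (hc : 0 < c) (h : C(K, ℝ)) : p (c • h) = c * p h := by
    refine le_antisymm (hp_smul_le c hc h) ?_
    have h1 := hp_smul_le c⁻¹ (inv_pos.2 hc) (c • h)
    rw [smul_smul, inv_mul_cancel₀ hc.ne', one_smul] at h1
    rwa [← div_eq_inv_mul, le_div_iff₀' hc] at h1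
  have hp_add (h k : C(K, ℝ)) : p (h + k) ≤ p h + p k := by
    rw [← sub_le_iff_le_add]
    refine le_csInf (hTne h) fun s hs => ?_
    rw [sub_le_comm]
    refine le_csInf (hTne k) fun t ht => ?_
    rw [sub_le_iff_le_add']
    exact hp_le (hTcongr (add_mem_majorantValues hYo hs ht) fun z hz => by
      rw [he h hz, he k hz]; rfl)
  let c : C(Space d × Space d, ℝ) := ⟨fun z => ‖z.1 - z.2‖ ^ 2, by fun_prop⟩
  obtain ⟨Λ, hΛc, hΛ⟩ := exists_linearMap_le_sublinear_eq hp_smul hp_add (-(c.restrict K))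
  have hΛ0 (h : C(K, ℝ)) (hh : 0 ≤ h) : 0 ≤ Λ h := by
    have h1 : (0 : ℝ) ∈ T (-h) := by
      refine ⟨fun _ => 0, fun _ => 0, integrableOn_const, const_mem_dualClass hd Y 0,
        fun x hx y hy => ?_, by simp⟩
      rw [he (-h) (hmemK hx hy), add_zero]
      exact neg_nonpos.2 (hh _)
    have h2 := (hΛ (-h)).trans (hp_le h1)
    rw [map_neg] at h2
    linarith
  obtain ⟨π, hπ, hπF⟩ := exists_measure_of_nonneg_functional hK Λ hΛ0
  refine ⟨π, hπ, fun F hF => ⟨(hπF ⟨F, hF⟩).1, fun t ht => ?_⟩, ?_⟩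
  · refine (hπF ⟨F, hF⟩).2.le.trans ((hΛ _).trans (hp_le (hTcongr ht fun z hz => rfl)))
  · refine (hπF c).2.le.trans ?_
    have h1 : -D ≤ p (-(c.restrict K)) := by
      refine le_csInf (hTne _) ?_
      rintro _ ⟨f, ψ, hf, hψ, hle, rfl⟩
      have h2 : ∀ x ∈ X, -f x ≤ quadTransform Y ψ x := fun x hx =>
        le_quadTransform hν.nonempty fun y hy => by
          have h3 := hle x hx y hy
          rw [he _ (hmemK hx hy)] at h3
          change -‖x - y‖ ^ 2 ≤ f x + ψ y at h3
          linarith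
      have h3 := setIntegral_mono_on hf.neg (integrableOn_quadTransform hXo.measurableSet hXb hYb
        hν.nonempty hψ.1.2) hXo.measurableSet h2
      have h4 := hD ψ hψ
      simp only [Pi.neg_apply] at h3
      rw [integral_neg] at h3
      simp only [dualFunctional] at h4
      linarith
    rw [← hΛc, map_neg] at h1
    linarith

/-- The dual measure is tested only against functions continuous on the whole space. The factor `1 -
v ^ k` vanishes on the boundary of `Y`, which with the boundedness of `ψ` makes the extension by
zero continuous. -/
theorem continuous_indicator_mul {Y : Set (Space d)} (hYo : IsOpen Y) {v ψ : Space d → ℝ}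
    (hv : Continuous v) (hv0 : ∀ y, 0 ≤ v y) (hvY : ∀ y, v y < 1 ↔ y ∈ Y)
    (hψ : ψ ∈ BoundedContinuousOn Y) (k : ℕ) :
    Continuous (Y.indicator fun y => ψ y * (1 - v y ^ k)) := by
  obtain ⟨hψc, C, hC⟩ := hψ
  refine continuous_iff_continuousAt.2 fun y => ?_
  by_cases hy : y ∈ Y
  · have h1 : ContinuousAt (fun y => ψ y * (1 - v y ^ k)) y :=
      (hψc.continuousAt (hYo.mem_nhds hy)).mul (by fun_prop)
    refine h1.congr ?_
    filter_upwards [hYo.mem_nhds hy] with z hz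
    rw [indicator_of_mem hz]
  · rw [ContinuousAt, indicator_of_notMem hy (fun y => ψ y * (1 - v y ^ k))]
    have h1 : Continuous fun z => |C| * (1 - min (v z) 1 ^ k) := by fun_prop
    have h2 : |C| * (1 - min (v y) 1 ^ k) = 0 := by
      rw [min_eq_right (not_lt.1 fun h => hy ((hvY y).1 h)), one_pow, sub_self, mul_zero]
    refine squeeze_zero_norm (a := fun z => |C| * (1 - min (v z) 1 ^ k)) (fun z => ?_)
      (h2 ▸ h1.tendsto y)
    have h3 : 0 ≤ 1 - min (v z) 1 ^ k :=
      sub_nonneg.2 (pow_le_one₀ (le_min (hv0 z) (zero_le_one' ℝ)) (min_le_right _ _))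
    by_cases hz : z ∈ Y
    · rw [indicator_of_mem hz, norm_mul, Real.norm_eq_abs, Real.norm_eq_abs]
      rw [min_eq_left ((hvY z).2 hz).le] at h3 ⊢
      rw [abs_of_nonneg h3]
      exact mul_le_mul_of_nonneg_right ((hC z hz).trans (le_abs_self C)) h3
    · rw [indicator_of_notMem hz, norm_zero]
      exact mul_nonneg (abs_nonneg C) h3

theorem pow_mem_dualClass (hd : 1 ≤ d) {Y : Set (Space d)} {v : Space d → ℝ}
    (hv : Continuous v) (hvc : ConvexOn ℝ univ v) (hv0 : ∀ y, 0 ≤ v y)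
    (hvY : ∀ y, v y < 1 ↔ y ∈ Y) (k : ℕ) : (fun y => v y ^ k) ∈ DualClass Y :=
  mem_dualClass (isSubharmonicOn_of_convexOn hd (hv.pow k) (hvc.pow (fun y _ => hv0 y) k) Y)
    ⟨(hv.pow k).continuousOn, 1, fun y hy => by
      rw [abs_of_nonneg (pow_nonneg (hv0 y) k)]
      exact pow_le_one₀ (hv0 y) ((hvY y).2 hy).le⟩

theorem tendsto_setIntegral_pow {Y : Set (Space d)} (hYo : IsOpen Y) {ν : Measure (Space d)}
    [IsFiniteMeasure ν] {v : Space d → ℝ} (hv : Continuous v) (hv0 : ∀ y, 0 ≤ v y)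
    (hvY : ∀ y, v y < 1 ↔ y ∈ Y) :
    Tendsto (fun k : ℕ => ∫ y in Y, v y ^ k ∂ν) atTop (𝓝 0) := by
  have h := tendsto_integral_of_dominated_convergence (μ := ν.restrict Y)
    (F := fun (k : ℕ) y => v y ^ k) (f := fun _ => 0) (fun _ => (1 : ℝ))
    (fun k => (hv.pow k).aestronglyMeasurable) (integrable_const _)
    (fun k => (ae_restrict_iff' hYo.measurableSet).2 (.of_forall fun y hy => by
      rw [Real.norm_of_nonneg (pow_nonneg (hv0 y) k)]
      exact pow_le_one₀ (hv0 y) ((hvY y).2 hy).le))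
    ((ae_restrict_iff' hYo.measurableSet).2 (.of_forall fun y hy =>
      tendsto_pow_atTop_nhds_zero_of_lt_one (hv0 y) ((hvY y).2 hy)))
  simpa using h

/-- The dual value bounds the transport cost to some member of the backward cone. -/
theorem exists_mem_backwardCone (hd : 1 ≤ d) {X Y : Set (Space d)} (hXo : IsOpen X)
    (hYo : IsOpen Y) (hYc : Convex ℝ Y) (hXb : Bornology.IsBounded X)
    (hYb : Bornology.IsBounded Y) {μ ν : Measure (Space d)} (hμ : IsProbOn X μ)
    (hν : IsProbOn Y ν) {D : ℝ} (hD : ∀ ψ ∈ DualClass Y, dualFunctional X Y μ ν ψ ≤ D) :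
    ∃ η ∈ backwardCone Y ν, transportCost μ η ≤ ENNReal.ofReal D := by
  have := hμ.1
  have := hν.1
  obtain ⟨π, hπ, hF, hc⟩ := exists_dual_measure hd hXo hYo hXb hYb hμ hν hD
  -- the first marginal
  have hle (f : Space d →ᵇ ℝ) : ∫ z, f z.1 ∂π ≤ ∫ x, f x ∂μ := by
    refine (hF _ (by fun_prop)).2 _ ⟨f, fun _ => 0, (f.integrable μ).integrableOn,
      const_mem_dualClass hd Y 0, fun x _ y _ => by simp, ?_⟩
    rw [hμ.restrict_eq]
    simp
  have hfst : π.map Prod.fst = μ := by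
    refine ext_of_forall_integral_eq_of_IsFiniteMeasure fun f => ?_
    rw [integral_map measurable_fst.aemeasurable f.continuous.aestronglyMeasurable]
    -- The class of `f` is a vector space, so `-f` gives the reverse inequality.
    refine le_antisymm (hle f) ?_
    have := hle (-f)
    simp only [BoundedContinuousFunction.coe_neg, Pi.neg_apply, integral_neg] at this
    linarith
  set η := π.map Prod.snd with hη
  have hηprob : IsProbabilityMeasure η := by
    refine ⟨?_⟩
    rw [hη, Measure.map_apply measurable_snd .univ, preimage_univ, ← preimage_univ (f := Prod.fst),
      ← Measure.map_apply measurable_fst .univ, hfst, measure_univ]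
  have hηF {g : Space d → ℝ} (hg : Continuous g) : Integrable g η ∧ ∀ φ ∈ DualClass Y,
      (∀ y ∈ Y, g y ≤ φ y) → ∫ y, g y ∂η ≤ ∫ y in Y, φ y ∂ν := by
    obtain ⟨h1, h2⟩ := hF (fun z => g z.2) (by fun_prop)
    refine ⟨(integrable_map_measure hg.aestronglyMeasurable measurable_snd.aemeasurable).2 h1,
      fun φ hφ hle => ?_⟩
    rw [hη, integral_map measurable_snd.aemeasurable hg.aestronglyMeasurable]
    exact h2 _ ⟨fun _ => 0, φ, integrableOn_zero, hφ, fun x _ y hy => by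
      simpa using hle y hy, by simp⟩
  obtain ⟨v, hv, hvc, hv0, hvY⟩ := exists_convex_defining_function hYo hYc hν.nonempty
  have hvm (k) := pow_mem_dualClass hd hv hvc hv0 hvY k
  have hηv (k : ℕ) : ∫ y, v y ^ k ∂η ≤ ∫ y in Y, v y ^ k ∂ν :=
    (hηF (hv.pow k)).2 _ (hvm k) fun y _ => le_rfl
  -- no mass outside `Y`
  have hηY : η Yᶜ = 0 := by
    -- `v ^ k` is a subharmonic barrier: at least `1` off `Y`, while its `ν`-integral over `Y` tends
    -- to `0`.
    have h1 (k : ℕ) : η.real Yᶜ ≤ ∫ y in Y, v y ^ k ∂ν := by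
      refine le_trans ?_ (hηv k)
      rw [← integral_indicator_one hYo.measurableSet.compl]
      refine integral_mono ((integrable_const (1 : ℝ)).indicator hYo.measurableSet.compl)
        (hηF (hv.pow k)).1 fun y => ?_
      by_cases hy : y ∈ Yᶜ
      · rw [indicator_of_mem hy]
        exact one_le_pow₀ (not_lt.1 fun h => hy ((hvY y).1 h))
      · rw [indicator_of_notMem hy]
        exact pow_nonneg (hv0 y) k
    have h2 := ge_of_tendsto' (tendsto_setIntegral_pow hYo hv hv0 hvY (ν := ν)) h1
    exact (measureReal_eq_zero_iff (measure_ne_top _ _)).1 (le_antisymm h2 measureReal_nonneg)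
  have hηon : IsProbOn Y η := ⟨hηprob, hηY⟩
  refine ⟨η, ⟨hηon, fun ψ hψ hψb => ?_⟩, ?_⟩
  · obtain ⟨C, hC⟩ := hψb.2
    have hC0 : 0 ≤ C := by
      obtain ⟨y, hy⟩ := hν.nonempty
      exact (abs_nonneg _).trans (hC y hy)
    have hψi := integrableOn_of_boundedContinuousOn hYo.measurableSet hψb (ν := ν)
    -- The cut-off `ψ * (1 - v ^ k)` need not be subharmonic, but on `Y` it lies below `ψ + C * v ^
    -- k`, which is; the error vanishes as `k` grows.
    have h1 (k : ℕ) : ∫ y in Y, ψ y * (1 - v y ^ k) ∂η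
        ≤ ∫ y in Y, ψ y ∂ν + C * ∫ y in Y, v y ^ k ∂ν := by
      rw [← integral_indicator hYo.measurableSet]
      refine ((hηF (continuous_indicator_mul hYo hv hv0 hvY hψb k)).2 _
        (dualClass_add_mul (mem_dualClass hψ hψb) (hvm k) zero_le_one hC0)
        fun y hy => ?_).trans (le_of_eq ?_)
      · rw [indicator_of_mem hy]
        have := mul_le_mul_of_nonneg_right (neg_le.1 (abs_le.1 (hC y hy)).1)
          (pow_nonneg (hv0 y) k)
        linarith
      · simp only [one_mul]
        rw [integral_add hψi
          ((integrableOn_of_boundedContinuousOn hYo.measurableSet (hvm k).2).const_mul C),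
          integral_const_mul]
    have h2 : Tendsto (fun k : ℕ => ∫ y in Y, ψ y * (1 - v y ^ k) ∂η) atTop
        (𝓝 (∫ y in Y, ψ y ∂η)) := by
      refine tendsto_integral_of_dominated_convergence (fun _ => C) (fun k => ?_)
        (integrable_const _) (fun k => ?_) ?_
      · exact (hψb.1.mul (by fun_prop)).aestronglyMeasurable hYo.measurableSet
      · refine (ae_restrict_iff' hYo.measurableSet).2 (.of_forall fun y hy => ?_)
        have h3 := pow_nonneg (hv0 y) k
        have h4 := pow_le_one₀ (n := k) (hv0 y) ((hvY y).2 hy).le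
        rw [norm_mul, Real.norm_eq_abs, Real.norm_of_nonneg (sub_nonneg.2 h4)]
        exact (mul_le_of_le_one_right (abs_nonneg _) (by linarith)).trans (hC y hy)
      · refine (ae_restrict_iff' hYo.measurableSet).2 (.of_forall fun y hy => ?_)
        have h3 := (((tendsto_pow_atTop_nhds_zero_of_lt_one (hv0 y) ((hvY y).2 hy)).const_sub
          1).const_mul (ψ y))
        simpa using h3
    have h3 := ((tendsto_setIntegral_pow hYo hv hv0 hvY (ν := ν)).const_mul C).const_add
      (∫ y in Y, ψ y ∂ν)
    rw [mul_zero, add_zero] at h3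
    exact le_of_tendsto_of_tendsto' h2 h3 h1
  · refine (iInf₂_le π ⟨hfst, rfl⟩).trans ?_
    rw [← ofReal_integral_eq_lintegral_ofReal (hF _ (by fun_prop)).1
      (.of_forall fun z => sq_nonneg _)]
    exact ENNReal.ofReal_le_ofReal hc

/-! ### Weak duality and conclusion. -/

/-- Integrate `Q₂(ψ)(x) ≤ ψ(y) + |x - y|²` against a coupling. Here `ψ` need be neither continuous
nor bounded above, so the inequality between its integrals is a hypothesis, not a consequence of the
order. -/
theorem ofReal_dualFunctional_le_transportCost {X Y : Set (Space d)} (hXo : IsOpen X)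
    (hXb : Bornology.IsBounded X) (hYb : Bornology.IsBounded Y) {μ ν η : Measure (Space d)}
    (hμ : IsProbOn X μ) (hη : IsProbOn Y η) {ψ : Space d → ℝ} (hψ : BddBelow (ψ '' Y))
    (hψη : IntegrableOn ψ Y η) (hle : ∫ y in Y, ψ y ∂η ≤ ∫ y in Y, ψ y ∂ν) :
    ENNReal.ofReal (dualFunctional X Y μ ν ψ) ≤ transportCost μ η := by
  have := hμ.1
  refine le_iInf₂ fun π hπ => ?_
  obtain ⟨h1, h2⟩ := hπ
  rcases eq_or_ne (∫⁻ p, ENNReal.ofReal (‖p.1 - p.2‖ ^ 2) ∂π) ∞ with htop | htop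
  · rw [htop]
    exact le_top
  have hcm : Continuous fun p : Space d × Space d => ‖p.1 - p.2‖ ^ 2 := by fun_prop
  have hci : Integrable (fun p : Space d × Space d => ‖p.1 - p.2‖ ^ 2) π := by
    refine ⟨hcm.aestronglyMeasurable, ?_⟩
    rw [hasFiniteIntegral_iff_ofReal (.of_forall fun z => sq_nonneg _)]
    exact htop.lt_top
  rw [← ofReal_integral_eq_lintegral_ofReal hci (.of_forall fun z => sq_nonneg _)]
  refine ENNReal.ofReal_le_ofReal ?_
  have hQ := integrableOn_quadTransform hXo.measurableSet hXb hYb hη.nonempty (μ := μ) hψ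
  rw [IntegrableOn, hμ.restrict_eq, ← h1] at hQ
  rw [IntegrableOn, hη.restrict_eq, ← h2] at hψη
  have hQ' := hQ.comp_measurable measurable_fst
  have hψ' : Integrable (fun p => ψ p.2) π := hψη.comp_measurable measurable_snd
  have hY : ∀ᵐ p ∂π, p.2 ∈ Y := by
    have h3 : ∀ᵐ y ∂(π.map Prod.snd), y ∈ Y := by
      rw [h2]
      exact mem_ae_iff.2 hη.2
    exact ae_of_ae_map measurable_snd.aemeasurable h3
  have h4 : ∫ p, quadTransform Y ψ p.1 ∂π ≤ ∫ p, (ψ p.2 + ‖p.1 - p.2‖ ^ 2) ∂π :=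
    integral_mono_ae hQ' (hψ'.add hci) (hY.mono fun p hp => quadTransform_le hψ p.1 hp)
  rw [integral_add hψ' hci, ← integral_map measurable_fst.aemeasurable hQ.aestronglyMeasurable,
    ← integral_map measurable_snd.aemeasurable hψη.aestronglyMeasurable, h1, h2] at h4
  rw [hη.restrict_eq] at hle
  rw [dualFunctional, hμ.restrict_eq]
  linarith

end SubharmonicProjection

/-- Integrability of `ψ₀` against `μbar` accompanies the integral inequality because the Bochner
integral of a non-integrable function is `0`, which would give that inequality another meaning. -/
theorem mainTheorem13 (d : ℕ) (hd : 1 ≤ d)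
    (X Y : Set (SubharmonicProjection.Space d))
    (hXo : IsOpen X) (hXc : Convex ℝ X) (hXb : Bornology.IsBounded X)
    (hYo : IsOpen Y) (hYc : Convex ℝ Y) (hYb : Bornology.IsBounded Y)
    (μ ν : Measure (SubharmonicProjection.Space d))
    (hμ : SubharmonicProjection.IsProbOn X μ)
    (hν : SubharmonicProjection.IsProbOn Y ν)
    (hac : ν ≪ volume)
    (hdens : ∃ a : ℝ≥0, 0 < a ∧ ∀ᵐ y ∂(volume.restrict Y), (a : ℝ≥0∞) ≤ ν.rnDeriv volume y) :
    ∃ ψ₀ ∈ SubharmonicProjection.SubharmonicBddBelow Y,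
      IntegrableOn ψ₀ Y ν ∧
      IntegrableOn (SubharmonicProjection.quadTransform Y ψ₀) X μ ∧
      SubharmonicProjection.dualValue X Y μ ν
        ≤ (SubharmonicProjection.dualFunctional X Y μ ν ψ₀ : EReal) ∧
      ∀ μbar : Measure (SubharmonicProjection.Space d),
        SubharmonicProjection.IsBackwardProjection Y μ ν μbar →
        IntegrableOn ψ₀ Y μbar →
        ∫ y in Y, ψ₀ y ∂μbar ≤ ∫ y in Y, ψ₀ y ∂ν →
        (SubharmonicProjection.dualFunctional X Y μ ν ψ₀ : EReal)
          = SubharmonicProjection.dualValue X Y μ ν := by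
  obtain ⟨ψ₀, hψ₀, hν', hμ', hle⟩ :=
    SubharmonicProjection.exists_dualValue_le hd hXo hYo hXb hYb hμ hν hac hdens
  refine ⟨ψ₀, hψ₀, hν', hμ', hle, fun μbar hbar hint hbarle => le_antisymm ?_ hle⟩
  obtain ⟨D, hD, hDle, -⟩ := SubharmonicProjection.exists_dualValue_eq hd hXo hYo hXb hYb hμ hν
  obtain ⟨η, hη, hηD⟩ :=
    SubharmonicProjection.exists_mem_backwardCone hd hXo hYo hYc hXb hYb hμ hν hDle
  have h1 : ENNReal.ofReal (SubharmonicProjection.dualFunctional X Y μ ν ψ₀)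
      ≤ ENNReal.ofReal D :=
    (SubharmonicProjection.ofReal_dualFunctional_le_transportCost hXo hXb hYb hμ hbar.1.1 hψ₀.2
      hint hbarle).trans (hbar.2.le.trans ((iInf₂_le η hη).trans hηD))
  -- The zero function competes; without this sign `ENNReal.ofReal` would lose the comparison.
  have hD0 : 0 ≤ D := by
    refine le_trans ?_ (hDle _ (SubharmonicProjection.const_mem_dualClass hd Y 0))
    rw [SubharmonicProjection.dualFunctional, integral_zero, sub_zero]
    exact integral_nonneg fun x =>
      SubharmonicProjection.le_quadTransform_of_le hν.nonempty fun _ _ => le_rfl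
  rw [hD, EReal.coe_le_coe_iff]
  exact (ENNReal.ofReal_le_ofReal_iff hD0).1 h1
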